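/- \textbf{Setting.} All manifolds (Hausdorff, second countable, without boundary), maps and sections are $C^\infty$; sections are local, with open domain $U\subseteq M$. Let $\pi\colon E\to M$ be a surjective submersion, $\dim M=m$, $\dim E=m+n$, and let $\eta$ be a volume form on $M$. Let $\pi^1\colon J^1\pi\to E$ be the first-order jet bundle (pairs $(u,A)$ with $A\colon T_{\pi(u)}M\to T_uE$ linear and $T_u\pi\circ A=\mathrm{id}$) and $\bar\pi^1=\pi\circ\pi^1$. Let $\Lambda^m_r(T^*E)$ be the bundle of $m$-forms on $E$ that vanish when $r$ of their arguments are $\pi$-vertical, $J^1\pi^*=\Lambda^m_2(T^*E)/\Lambda^m_1(T^*E)$, $\mu\colon\Lambda^m_2(T^*E)\to J^1\pi^*$ the quotient map, $\pi^r_E\colon J^1\pi^*\to E$ the projection and $\bar\pi^r_E=\pi\circ\pi^r_E$. Let $\rho\colon N\to M$ be one of $\pi,\bar\pi^1,\bar\pi^r_E$ and $\mathcal D$ a field of tangent subspaces on $N$. A section $\psi$ of $\rho$ over $U$ is an \emph{integral section} of $\mathcal D$ if $T_x\psi(T_xM)=\mathcal D_{\psi(x)}$ for all $x\in U$; $\mathcal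 D$ is \emph{integrable} if through every point of $N$ passes an integral section, and \emph{$\rho$-transverse} if $\mathcal D_p\cap\ker T_p\rho=0$ for all $p$. For $S\subseteq N$, a section $\psi$ over $U$ has \emph{boundary conditions in} $S$ if either $\psi(x)\in S$ for some $x\in U$, or there is an open $O\subseteq M$ with $O\cap\partial U\neq\emptyset$ such that $\psi$ extends continuously to $U\cup(O\cap\partial U)$ with $\psi(O\cap\partial U)\subseteq S$. \textbf{(a) Lagrangian case.} Let $L\colon J^1\pi\to\mathbb R$ be smooth and let $\Theta_{\mathcal L}$ be the Poincaré–Cartan $m$-form of $\mathcal L=L\,\eta$: in adapted coordinates $(x^i,u^\alpha,u^\alpha_i)$, $$\Theta_{\mathcal L}=\sum_{i,\alpha}\frac{\partial L}{\partial u^\alpha_i}\,\Bigl(du^\alpha-\sum_k u^\alpha_k\,dx^k\Bigr)\wedge i(\partial/\partial x^i)\eta+L\,\eta ,\qquad \Omega_{\mathcal L}=-d\Theta_{\mathcal L}.$$ Let $\mathcal D_{\mathcal L}$ be a smooth, $m$-dimensional, $\bar\pi^1$-transverse, integrable distribution on $J^1\pi$ whose integral sections $\psi$ are all prolongations $j^1\phi$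 of sections $\phi$ of $\pi$ and satisfy $\psi^*i(X)\Omega_{\mathcal L}=0$ for every vector field $X$ on $J^1\pi$. Let $\Psi$ be a solution of the generalized Lagrangian Hamilton–Jacobi problem, i.e. a global section of $\pi^1$ that is integrable (through every $u\in E$ there is a section $\gamma$ of $\pi$ with $\Psi\circ\gamma=j^1\gamma$) and such that, for every integral section $\gamma$ of the distribution $\mathcal D=T\pi^1(\mathcal D_{\mathcal L}|_{\operatorname{Im}\Psi})$ on $E$, i.e. $\mathcal D_u=T_{\Psi(u)}\pi^1\bigl((\mathcal D_{\mathcal L})_{\Psi(u)}\bigr)$, the section $\Psi\circ\gamma$ is an integral section of $\mathcal D_{\mathcal L}$. Then the integral sections of $\mathcal D_{\mathcal L}$ with boundary conditions in $\operatorname{Im}\Psi$ project to the integral sections of $\mathcal D$: if $\psi$ is an integral section of $\mathcal D_{\mathcal L}$ over a connected open set $U$ with boundary conditions in $\operatorname{Im}\Psi$, then $\pi^1\circ\psi$ is an integral section of $\mathcal D$; and every integral section $\gamma$ of $\mathcal D$ over an open set $U$ is $\pi^1\circ\psi$ for an integral section $\psi$ of $\mathcal D_{\mathcal L}$ over $U$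 with $\psi(U)\subseteq\operatorname{Im}\Psi$. \textbf{(b) Hamiltonian case.} Let $h$ be a smooth section of $\mu$, $\Theta_h=h^*\Theta$ with $\Theta$ the tautological $m$-form of $\Lambda^m_2(T^*E)$, and $\Omega_h=-d\Theta_h$. Let $\mathcal D_h$ be a smooth, $m$-dimensional, $\bar\pi^r_E$-transverse, integrable distribution on $J^1\pi^*$ whose integral sections $\psi$ satisfy $\psi^*i(X)\Omega_h=0$ for every vector field $X$ on $J^1\pi^*$. Let $s$ be a solution of the generalized Hamiltonian Hamilton–Jacobi problem, i.e. a global section of $\pi^r_E$ such that the distribution $\mathcal D=T\pi^r_E(\mathcal D_h|_{\operatorname{Im}s})$ on $E$ is integrable and, for every integral section $\gamma$ of $\mathcal D$, the section $s\circ\gamma$ is an integral section of $\mathcal D_h$. Then the integral sections of $\mathcal D_h$ with boundary conditions in $\operatorname{Im}s$ project to the integral sections of $\mathcal D$: if $\psi$ is an integral section of $\mathcal D_h$ over a connected open set $U$ with boundary conditions in $\operatorname{Im}s$, then $\pi^r_E\circ\psi$ is an integral section of $\mathcal D$; and every integral section $\gamma$ of $\mathcal D$ over an open set $U$ is $\pi^r_E\circ\psi$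 for an integral section $\psi$ of $\mathcal D_h$ over $U$ with $\psi(U)\subseteq\operatorname{Im}s$. -/

import Mathlib

open Set Topology
open scoped Manifold ContDiff
noncomputable section
namespace FieldTheory

/-- The model space `ℝ^k`. -/
abbrev RSpace (k : ℕ) : Type := EuclideanSpace ℝ (Fin k)

section Frames
variable (H : Type*) [NormedAddCommGroup H] [NormedSpace ℝ H]
  {N : Type*} [TopologicalSpace N] [ChartedSpace H N]
  {W : Type*} [NormedAddCommGroup W] [NormedSpace ℝ W]
  {W' : Type*} [NormedAddCommGroup W'] [NormedSpace ℝ W']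

/-- The derivative of a chart `e` at `u`. -/
def chartD (e : OpenPartialHomeomorph N W) (u : N) : TangentSpace 𝓘(ℝ, H) u →L[ℝ] W :=
  mfderiv 𝓘(ℝ, H) 𝓘(ℝ, W) e u

/-- The inverse of the derivative of a chart `e` at `u`. -/
def chartDinv (e : OpenPartialHomeomorph N W) (u : N) : W →L[ℝ] TangentSpace 𝓘(ℝ, H) u :=
  (chartD H e u).inverse

variable {H}

/-- `e` is a chart of the smooth structure of `N`, with values in an arbitrary normed space. -/
structure IsSmoothChart (H : Type*) [NormedAddCommGroup H] [NormedSpace ℝ H]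
  {N : Type*} [TopologicalSpace N] [ChartedSpace H N]
  {W : Type*} [NormedAddCommGroup W] [NormedSpace ℝ W] (e : OpenPartialHomeomorph N W) : Prop where
  smooth : ContMDiffOn 𝓘(ℝ, H) 𝓘(ℝ, W) ∞ e e.source
  smooth_symm : ContMDiffOn 𝓘(ℝ, W) 𝓘(ℝ, H) ∞ e.symm e.target

variable {e : OpenPartialHomeomorph N W} {e' : OpenPartialHomeomorph N W'}

lemma IsSmoothChart.mdiff (he : IsSmoothChart H e) : e.MDifferentiable 𝓘(ℝ, H) 𝓘(ℝ, W) :=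
  ⟨he.smooth.mdifferentiableOn (by simp), he.smooth_symm.mdifferentiableOn (by simp)⟩

lemma IsSmoothChart.exists_equiv [IsManifold 𝓘(ℝ, H) ∞ N] (he : IsSmoothChart H e) {u : N} (hu : u ∈ e.source) :
    ∃ f : TangentSpace 𝓘(ℝ, H) u ≃L[ℝ] W, chartD H e u = f := by
  exact ⟨he.mdiff.mfderiv hu, rfl⟩

lemma IsSmoothChart.inv_comp [IsManifold 𝓘(ℝ, H) ∞ N] (he : IsSmoothChart H e) {u : N} (hu : u ∈ e.source) :
    (chartDinv H e u).comp (chartD H e u) = ContinuousLinearMap.id ℝ _ := by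
  obtain ⟨f, hf⟩ := he.exists_equiv hu
  rw [chartDinv, hf, ContinuousLinearMap.inverse_equiv]
  ext v; simp

lemma IsSmoothChart.comp_inv [IsManifold 𝓘(ℝ, H) ∞ N] (he : IsSmoothChart H e) {u : N} (hu : u ∈ e.source) :
    (chartD H e u).comp (chartDinv H e u) = ContinuousLinearMap.id ℝ _ := by
  obtain ⟨f, hf⟩ := he.exists_equiv hu
  rw [chartDinv, hf, ContinuousLinearMap.inverse_equiv]
  ext v; simp

lemma chartD_transition [IsManifold 𝓘(ℝ, H) ∞ N] (he : IsSmoothChart H e) (he' : IsSmoothChart H e')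
    {u : N} (hu : u ∈ e.source) (hu' : u ∈ e'.source) :
    (chartD H e' u).comp (chartDinv H e u) = fderiv ℝ (e' ∘ e.symm) (e u) := by
  have h1 : MDifferentiableAt 𝓘(ℝ, H) 𝓘(ℝ, W') e' u := he'.mdiff.mdifferentiableAt hu'
  have h2 : MDifferentiableAt 𝓘(ℝ, W) 𝓘(ℝ, H) e.symm (e u) :=
    he.mdiff.symm.mdifferentiableAt (e.map_source hu)
  have h3 : (mfderiv 𝓘(ℝ, H) 𝓘(ℝ, W') e' u) = ((fderiv ℝ (e' ∘ e.symm) (e u)).comp (chartD H e u)) := by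
    have h4 : MDifferentiableAt 𝓘(ℝ, W) 𝓘(ℝ, W') (e' ∘ e.symm) (e u) := by
      apply MDifferentiableAt.comp (I' := 𝓘(ℝ, H)) (e u) _ h2
      rwa [e.left_inv hu]
    have h5 := mfderiv_comp (I' := 𝓘(ℝ, W)) u h4 (he.mdiff.mdifferentiableAt hu)
    rw [mfderiv_eq_fderiv] at h5
    refine Eq.trans ?_ h5
    apply Filter.EventuallyEq.mfderiv_eq
    filter_upwards [e.open_source.mem_nhds hu] with y hy
    simp [e.left_inv hy]
  have h6 : chartD H e' u = ((fderiv ℝ (e' ∘ e.symm) (e u)).comp (chartD H e u)) := h3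
  rw [h6, ContinuousLinearMap.comp_assoc, he.comp_inv hu, ContinuousLinearMap.comp_id]

lemma transition_contDiffOn [IsManifold 𝓘(ℝ, H) ∞ N] (he : IsSmoothChart H e) (he' : IsSmoothChart H e') :
    ContDiffOn ℝ ∞ (e' ∘ e.symm) (e.target ∩ e.symm ⁻¹' e'.source) := by
  rw [← contMDiffOn_iff_contDiffOn]
  exact he'.smooth.comp (he.smooth_symm.mono inter_subset_left) inter_subset_right

lemma transition_isOpen :
    IsOpen (e.target ∩ e.symm ⁻¹' e'.source) := by
  exact e.symm.isOpen_inter_preimage e'.open_source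

end Frames

variable (m n : ℕ)
  {M : Type*} [TopologicalSpace M] [ChartedSpace (RSpace m) M] 
  {E : Type*} [TopologicalSpace E] [ChartedSpace (RSpace (m + n)) E] 

/-- `π : E → M` is a fibered manifold: a surjective submersion, with `dim M = m`, `dim E = m + n`. -/
class FiberedManifold (π : E → M) : Prop where
  surjective : Function.Surjective π
  submersion : Manifold.IsSubmersion 𝓘(ℝ, RSpace (m + n)) 𝓘(ℝ, RSpace m) ∞ π

/-- Adapted coordinates `(x^i, u^α)` on `E`, together with the coordinates `(x^i)` on `M`. -/
structure AdaptedChart (π : E → M) where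
  tot : OpenPartialHomeomorph E (RSpace m × RSpace n)
  base : OpenPartialHomeomorph M (RSpace m)
  smooth_tot : IsSmoothChart (RSpace (m + n)) tot
  smooth_base : IsSmoothChart (RSpace m) base
  maps : ∀ u ∈ tot.source, π u ∈ base.source
  fst_eq : ∀ u ∈ tot.source, (tot u).1 = base (π u)

variable {m n}

lemma exists_adaptedChart [IsManifold 𝓘(ℝ, RSpace m) ∞ M] [IsManifold 𝓘(ℝ, RSpace (m + n)) ∞ E]
    (π : E → M) [h : FiberedManifold m n π] (u : E) :
    ∃ a : AdaptedChart m n π, u ∈ a.tot.source := by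
  obtain ⟨F, _, _, hF⟩ := h.submersion
  have hu := hF u
  have hfd : FiniteDimensional ℝ (RSpace m × F) := hu.equiv.toLinearEquiv.finiteDimensional
  have : FiniteDimensional ℝ F :=
    FiniteDimensional.of_injective (LinearMap.inr ℝ (RSpace m) F) LinearMap.inr_injective
  have hd : Module.finrank ℝ F = n := by
    have := hu.equiv.toLinearEquiv.finrank_eq
    simp at this
    omega
  let g : F ≃L[ℝ] RSpace n := ContinuousLinearEquiv.ofFinrankEq (by simp [hd])
  let L : RSpace (m + n) ≃L[ℝ] RSpace m × RSpace n :=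
    hu.equiv.trans ((ContinuousLinearEquiv.refl ℝ _).prodCongr g)
  refine ⟨⟨hu.domChart.trans L.toHomeomorph.toOpenPartialHomeomorph, hu.codChart, ⟨?_, ?_⟩, ⟨?_, ?_⟩, ?_, ?_⟩, ?_⟩
  · have := contMDiffOn_of_mem_maximalAtlas hu.domChart_mem_maximalAtlas
    have hL : ContMDiff 𝓘(ℝ, RSpace (m + n)) 𝓘(ℝ, RSpace m × RSpace n) ∞ L := L.contDiff.contMDiff
    simpa using hL.comp_contMDiffOn this
  · have := contMDiffOn_symm_of_mem_maximalAtlas hu.domChart_mem_maximalAtlas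
    have hL : ContMDiff 𝓘(ℝ, RSpace m × RSpace n) 𝓘(ℝ, RSpace (m + n)) ∞ L.symm := L.symm.contDiff.contMDiff
    exact this.comp hL.contMDiffOn (by intro x hx; simpa using hx)
  · exact contMDiffOn_of_mem_maximalAtlas hu.codChart_mem_maximalAtlas
  · exact contMDiffOn_symm_of_mem_maximalAtlas hu.codChart_mem_maximalAtlas
  · intro x hx
    exact hu.source_subset_preimage_source (by simpa using hx)
  · intro x hx
    have hx' : x ∈ hu.domChart.source := by simpa using hx
    have hm : hu.domChart x ∈ (hu.domChart.extend 𝓘(ℝ, RSpace (m + n))).target := by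
      simpa using hu.domChart.map_source hx'
    have := hu.writtenInCharts hm
    simp [hu.domChart.left_inv hx'] at this
    simp [L, this]
  · simpa using hu.mem_domChart_source


section Jets

variable [IsManifold 𝓘(ℝ, RSpace m) ∞ M] [IsManifold 𝓘(ℝ, RSpace (m + n)) ∞ E]
  {π : E → M}

lemma AdaptedChart.fst_comp (hπ : MDifferentiable 𝓘(ℝ, RSpace (m + n)) 𝓘(ℝ, RSpace m) π)
    (a : AdaptedChart m n π) {u : E} (hu : u ∈ a.tot.source) :
    (ContinuousLinearMap.fst ℝ (RSpace m) (RSpace n)).comp (chartD (RSpace (m + n)) a.tot u) =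
      (chartD (RSpace m) a.base (π u)).comp
        (mfderiv 𝓘(ℝ, RSpace (m + n)) 𝓘(ℝ, RSpace m) π u) := by
  have h1 : mfderiv 𝓘(ℝ, RSpace (m + n)) 𝓘(ℝ, RSpace m) (Prod.fst ∘ a.tot) u =
      mfderiv 𝓘(ℝ, RSpace (m + n)) 𝓘(ℝ, RSpace m) (a.base ∘ π) u := by
    apply Filter.EventuallyEq.mfderiv_eq
    filter_upwards [a.tot.open_source.mem_nhds hu] with y hy
    exact a.fst_eq y hy
  have h2 : mfderiv 𝓘(ℝ, RSpace (m + n)) 𝓘(ℝ, RSpace m) (a.base ∘ π) u =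
      (chartD (RSpace m) a.base (π u)).comp
        (mfderiv 𝓘(ℝ, RSpace (m + n)) 𝓘(ℝ, RSpace m) π u) :=
    mfderiv_comp u (a.smooth_base.mdiff.mdifferentiableAt (a.maps u hu)) (hπ u)
  have h3 : MDifferentiableAt 𝓘(ℝ, RSpace m × RSpace n) 𝓘(ℝ, RSpace m)
      (Prod.fst : RSpace m × RSpace n → RSpace m) (a.tot u) :=
    (ContinuousLinearMap.fst ℝ (RSpace m) (RSpace n)).mdifferentiableAt
  have h4 : mfderiv 𝓘(ℝ, RSpace (m + n)) 𝓘(ℝ, RSpace m) (Prod.fst ∘ a.tot) u =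
      (mfderiv 𝓘(ℝ, RSpace m × RSpace n) 𝓘(ℝ, RSpace m)
        (Prod.fst : RSpace m × RSpace n → RSpace m) (a.tot u)).comp
        (chartD (RSpace (m + n)) a.tot u) :=
    mfderiv_comp u h3 (a.smooth_tot.mdiff.mdifferentiableAt hu)
  have h5 : mfderiv 𝓘(ℝ, RSpace m × RSpace n) 𝓘(ℝ, RSpace m)
        (Prod.fst : RSpace m × RSpace n → RSpace m) (a.tot u) =
        ContinuousLinearMap.fst ℝ (RSpace m) (RSpace n) := by
    rw [mfderiv_eq_fderiv]; exact fderiv_fst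
  refine Eq.trans ?_ (h4.symm.trans (h1.trans h2))
  exact congrArg (fun q : RSpace m × RSpace n →L[ℝ] RSpace m =>
    q.comp (chartD (RSpace (m + n)) a.tot u)) h5.symm

lemma FiberedManifold.contMDiff {π : E → M} [h : FiberedManifold m n π] :
    ContMDiff 𝓘(ℝ, RSpace (m + n)) 𝓘(ℝ, RSpace m) ∞ π :=
  h.submersion.contMDiff

lemma FiberedManifold.mdifferentiable (π : E → M) [h : FiberedManifold m n π] :
    MDifferentiable 𝓘(ℝ, RSpace (m + n)) 𝓘(ℝ, RSpace m) π :=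
  (FiberedManifold.contMDiff (m := m) (n := n) (π := π)).mdifferentiable (by simp)

variable (m n π) in
/-- The fibre of `π¹ : J¹π → E` over `u`: the `1`-jets at `π u` of local sections through `u`,
i.e. the linear maps `A : T_{π u}M → T_uE` with `Tπ ∘ A = id`. -/
def JetFiber (u : E) : Type :=
  {A : TangentSpace 𝓘(ℝ, RSpace m) (π u) →L[ℝ] TangentSpace 𝓘(ℝ, RSpace (m + n)) u //
    (mfderiv 𝓘(ℝ, RSpace (m + n)) 𝓘(ℝ, RSpace m) π u).comp A = ContinuousLinearMap.id ℝ _}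

variable (m n π) in
/-- The first-order jet bundle `J¹π`. -/
@[ext] structure Jet where
  pt : E
  lin : JetFiber m n π pt

variable (m n) in
/-- The model space of the coordinates `(x^i, u^α, u_i^α)` of `J¹π`. -/
abbrev JetModel : Type := (RSpace m × RSpace n) × (RSpace m →L[ℝ] RSpace n)

/-- The coordinates `((x^i, u^α), u_i^α)` of a jet. -/
def AdaptedChart.jetCoord (a : AdaptedChart m n π) (j : Jet m n π) : JetModel m n :=
  (a.tot j.pt, (ContinuousLinearMap.snd ℝ (RSpace m) (RSpace n)).comp
    ((chartD (RSpace (m + n)) a.tot j.pt).comp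
      (j.lin.1.comp (chartDinv (RSpace m) a.base (π j.pt)))))

/-- The linear map over `u` with coordinates `u_i^α = B`. -/
def AdaptedChart.jetLin (a : AdaptedChart m n π) (u : E) (B : RSpace m →L[ℝ] RSpace n) :
    TangentSpace 𝓘(ℝ, RSpace m) (π u) →L[ℝ] TangentSpace 𝓘(ℝ, RSpace (m + n)) u :=
  (chartDinv (RSpace (m + n)) a.tot u).comp
    (((ContinuousLinearMap.id ℝ (RSpace m)).prod B).comp (chartD (RSpace m) a.base (π u)))

lemma AdaptedChart.jetLin_prop [FiberedManifold m n π] (a : AdaptedChart m n π) {u : E}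
    (hu : u ∈ a.tot.source) (B : RSpace m →L[ℝ] RSpace n) :
    (mfderiv 𝓘(ℝ, RSpace (m + n)) 𝓘(ℝ, RSpace m) π u).comp (a.jetLin u B) =
      ContinuousLinearMap.id ℝ _ := by
  have h1 := a.fst_comp (FiberedManifold.mdifferentiable π) hu
  have h2 := a.smooth_base.inv_comp (a.maps u hu)
  have h3 := a.smooth_tot.comp_inv hu
  ext1 v
  have e1 := fun w => DFunLike.congr_fun h1 w
  have e2 := fun w => DFunLike.congr_fun h2 w
  have e3 := fun w => DFunLike.congr_fun h3 w
  simp only [ContinuousLinearMap.comp_apply, ContinuousLinearMap.id_apply] at e1 e2 e3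
  rw [ContinuousLinearMap.comp_apply, ← e2 (mfderiv 𝓘(ℝ, RSpace (m + n)) 𝓘(ℝ, RSpace m) π u (a.jetLin u B v)), ← e1]
  simp only [jetLin, ContinuousLinearMap.comp_apply, e3]
  exact e2 v

lemma nonempty_jetFiber [FiberedManifold m n π] (u : E) : Nonempty (JetFiber m n π u) := by
  obtain ⟨a, ha⟩ := exists_adaptedChart (m := m) (n := n) π u
  exact ⟨⟨a.jetLin (m := m) (n := n) u 0, a.jetLin_prop ha 0⟩⟩

open Classical in
/-- The jet with given coordinates. -/
def AdaptedChart.jetOfCoord [FiberedManifold m n π] (a : AdaptedChart m n π) (z : JetModel m n) :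
    Jet m n π where
  pt := a.tot.symm z.1
  lin := if h : a.tot.symm z.1 ∈ a.tot.source then
      ⟨a.jetLin (a.tot.symm z.1) z.2, a.jetLin_prop h z.2⟩
    else (nonempty_jetFiber (a.tot.symm z.1)).some

lemma AdaptedChart.jetOfCoord_lin [FiberedManifold m n π] (a : AdaptedChart m n π)
    (z : JetModel m n) (h : a.tot.symm z.1 ∈ a.tot.source) :
    (a.jetOfCoord z).lin.1 = a.jetLin (a.tot.symm z.1) z.2 :=
  congrArg Subtype.val (dif_pos h)

/-- The chart `(x^i, u^α, u_i^α)` of `J¹π` induced by an adapted chart of `E`. -/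
def AdaptedChart.jetChart [FiberedManifold m n π] (a : AdaptedChart m n π) :
    PartialEquiv (Jet m n π) (JetModel m n) where
  toFun := a.jetCoord
  invFun := a.jetOfCoord
  source := {j | j.pt ∈ a.tot.source}
  target := {z | z.1 ∈ a.tot.target}
  map_source' j hj := a.tot.map_source hj
  map_target' z hz := a.tot.map_target hz
  left_inv' := by
    rintro ⟨u, A⟩ (hu : u ∈ a.tot.source)
    have key : a.jetLin u (a.jetCoord ⟨u, A⟩).2 = A.1 := by
      have h1 := a.fst_comp (FiberedManifold.mdifferentiable π) hu
      have h2 := a.smooth_base.inv_comp (a.maps u hu)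
      have h3 := a.smooth_tot.inv_comp hu
      ext1 v
      have e1 := fun w => DFunLike.congr_fun h1 w
      have e2 := fun w => DFunLike.congr_fun h2 w
      have e3 := fun w => DFunLike.congr_fun h3 w
      have e4 := fun w => DFunLike.congr_fun A.2 w
      simp only [ContinuousLinearMap.comp_apply, ContinuousLinearMap.id_apply] at e1 e2 e3 e4
      have : ((ContinuousLinearMap.id ℝ (RSpace m)).prod (a.jetCoord ⟨u, A⟩).2)
          (chartD (RSpace m) a.base (π u) v) = chartD (RSpace (m + n)) a.tot u (A.1 v) := by
        refine Prod.ext ?_ ?_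
        · exact ((e1 _).trans (congrArg _ (e4 v))).symm
        · simp only [jetCoord, ContinuousLinearMap.prod_apply, ContinuousLinearMap.comp_apply]
          rw [e2]; rfl
      simp only [jetLin, ContinuousLinearMap.comp_apply, this, e3]
    have hpt : a.tot.symm (a.tot u) = u := a.tot.left_inv hu
    have : ∀ u' (_ : u' = u) (A' : JetFiber m n π u'),
        A'.1 = a.jetLin u' (a.jetCoord ⟨u, A⟩).2 → (⟨u', A'⟩ : Jet m n π) = ⟨u, A⟩ := by
      rintro u' rfl A' hA'
      congr 1
      exact Subtype.ext (hA'.trans key)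
    refine this _ hpt (a.jetOfCoord (a.jetCoord ⟨u, A⟩)).lin (a.jetOfCoord_lin _ ?_)
    exact hpt.symm ▸ hu
  right_inv' := by
    rintro ⟨z, B⟩ (hz : z ∈ a.tot.target)
    have hu : a.tot.symm z ∈ a.tot.source := a.tot.map_target hz
    have h2 := a.smooth_base.comp_inv (a.maps _ hu)
    have h3 := a.smooth_tot.comp_inv hu
    have e2 := fun w => DFunLike.congr_fun h2 w
    have e3 := fun w => DFunLike.congr_fun h3 w
    simp only [ContinuousLinearMap.comp_apply, ContinuousLinearMap.id_apply] at e2 e3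
    refine Prod.ext (a.tot.right_inv hz) ?_
    ext1 v
    have hl := a.jetOfCoord_lin (z, B) hu
    simp only [jetCoord, hl, ContinuousLinearMap.comp_apply, jetLin]
    change (chartD (RSpace (m + n)) a.tot (a.tot.symm z) (chartDinv (RSpace (m + n)) a.tot
      (a.tot.symm z) ((ContinuousLinearMap.id ℝ (RSpace m)).prod B
      (chartD (RSpace m) a.base (π (a.tot.symm z)) (chartDinv (RSpace m) a.base
        (π (a.tot.symm z)) v))))).2 = B v
    rw [e3, e2]
    rfl

lemma AdaptedChart.jetChart_trans_source [FiberedManifold m n π] (a b : AdaptedChart m n π) :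
    (a.jetChart.symm.trans b.jetChart).source =
      (a.tot.target ∩ a.tot.symm ⁻¹' b.tot.source) ×ˢ univ := by
  ext z
  have : (a.jetChart.symm.trans b.jetChart).source =
    {z | z.1 ∈ a.tot.target ∧ a.tot.symm z.1 ∈ b.tot.source} := rfl
  rw [this]
  simp

lemma AdaptedChart.contDiffOn_jet [FiberedManifold m n π] (a b : AdaptedChart m n π) :
    ContDiffOn ℝ ∞ (a.jetChart.symm.trans b.jetChart)
      (a.jetChart.symm.trans b.jetChart).source := by
  rw [a.jetChart_trans_source b]
  set S := a.tot.target ∩ a.tot.symm ⁻¹' b.tot.source with hS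
  have hSo : IsOpen S := transition_isOpen
  set τ := b.tot ∘ a.tot.symm with hτ
  have hτs : ContDiffOn ℝ ∞ τ S := transition_contDiffOn a.smooth_tot b.smooth_tot
  set S' := b.base.target ∩ b.base.symm ⁻¹' a.base.source with hS'
  have hSo' : IsOpen S' := transition_isOpen
  set σ := a.base ∘ b.base.symm with hσ
  have hσs : ContDiffOn ℝ ∞ σ S' := transition_contDiffOn b.smooth_base a.smooth_base
  have hmaps : ∀ z ∈ S, (τ z).1 ∈ S' := by
    rintro z ⟨hz, hz'⟩
    have hb := b.fst_eq _ hz'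
    have hm := b.maps _ hz'
    have hma := a.maps _ (a.tot.map_target hz)
    simp only [hτ, Function.comp, hb, hS', mem_inter_iff, mem_preimage]
    exact ⟨b.base.map_source hm, by rwa [b.base.left_inv hm]⟩
  have hform : EqOn (a.jetChart.symm.trans b.jetChart)
      (fun z => (τ z.1, (ContinuousLinearMap.snd ℝ (RSpace m) (RSpace n)).comp
        ((fderiv ℝ τ z.1).comp (((ContinuousLinearMap.id ℝ (RSpace m)).prod z.2).comp
          (fderiv ℝ σ (τ z.1).1))))) (S ×ˢ univ) := by
    rintro ⟨z, B⟩ ⟨⟨hz, hz'⟩, -⟩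
    have hu : a.tot.symm z ∈ a.tot.source := a.tot.map_target hz
    refine Prod.ext rfl ?_
    have t1 := chartD_transition a.smooth_tot b.smooth_tot hu hz'
    have t2 := chartD_transition b.smooth_base a.smooth_base (b.maps _ hz') (a.maps _ hu)
    rw [a.tot.right_inv hz] at t1
    have hb : b.base (π (a.tot.symm z)) = (τ z).1 := (b.fst_eq _ hz').symm
    rw [hb] at t2
    change (ContinuousLinearMap.snd ℝ (RSpace m) (RSpace n)).comp
      ((chartD (RSpace (m + n)) b.tot (a.tot.symm z)).comp
      ((a.jetOfCoord (z, B)).lin.1.comp (chartDinv (RSpace m) b.base (π (a.tot.symm z))))) = _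
    rw [a.jetOfCoord_lin (z, B) hu]
    change _ = (ContinuousLinearMap.snd ℝ (RSpace m) (RSpace n)).comp
        ((fderiv ℝ τ z).comp (((ContinuousLinearMap.id ℝ (RSpace m)).prod B).comp
          (fderiv ℝ σ (τ z).1)))
    rw [hτ, hσ, ← t1, ← t2]
    rfl
  refine ContDiffOn.congr ?_ hform
  have hfst : ContDiffOn ℝ ∞ (fun z : JetModel m n => z.1) (S ×ˢ univ) := contDiff_fst.contDiffOn
  have m1 : MapsTo (fun z : JetModel m n => z.1) (S ×ˢ univ) S := fun z hz => hz.1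
  have c1 : ContDiffOn ℝ ∞ (fun z : JetModel m n => τ z.1) (S ×ˢ univ) := hτs.comp hfst m1
  have c2 : ContDiffOn ℝ ∞ (fun z : JetModel m n => fderiv ℝ τ z.1) (S ×ˢ univ) :=
    (hτs.fderiv_of_isOpen hSo (m := ∞) (by simp)).comp hfst m1
  have c3 : ContDiffOn ℝ ∞ (fun z : JetModel m n => fderiv ℝ σ (τ z.1).1) (S ×ˢ univ) :=
    (hσs.fderiv_of_isOpen hSo' (m := ∞) (by simp)).comp c1.fst (fun z hz => hmaps _ hz.1)
  have c4 : ContDiffOn ℝ ∞ (fun z : JetModel m n => (ContinuousLinearMap.id ℝ (RSpace m)).prod z.2)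
      (S ×ˢ univ) := by
    have : ContDiff ℝ ∞ (fun z : JetModel m n =>
        (ContinuousLinearMap.inl ℝ (RSpace m) (RSpace n)) +
          (ContinuousLinearMap.inr ℝ (RSpace m) (RSpace n)).comp z.2) :=
      contDiff_const.add (contDiff_const.clm_comp contDiff_snd)
    refine this.contDiffOn.congr fun z _ => ?_
    ext1 v
    simp
  exact c1.prodMk (contDiffOn_const.clm_comp (c2.clm_comp (c4.clm_comp c3)))

variable (m n π) in
/-- A chosen adapted chart around `u`. -/
def chartNear [FiberedManifold m n π] (u : E) : AdaptedChart m n π := (exists_adaptedChart π u).choose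

lemma mem_chartNear [FiberedManifold m n π] (u : E) : u ∈ (chartNear m n π u).tot.source :=
  (exists_adaptedChart π u).choose_spec

variable (m n π) in
/-- The smooth atlas of `J¹π` given by the induced charts. -/
def jetCore [FiberedManifold m n π] : ChartedSpaceCore (JetModel m n) (Jet m n π) where
  atlas := range AdaptedChart.jetChart
  chartAt j := (chartNear m n π j.pt).jetChart
  mem_chart_source j := mem_chartNear (m := m) (n := n) j.pt
  chart_mem_atlas j := ⟨_, rfl⟩
  open_source := by
    rintro _ _ ⟨a, rfl⟩ ⟨b, rfl⟩
    rw [a.jetChart_trans_source b]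
    exact transition_isOpen.prod isOpen_univ
  continuousOn_toFun := by
    rintro _ _ ⟨a, rfl⟩ ⟨b, rfl⟩
    exact (a.contDiffOn_jet b).continuousOn

instance [FiberedManifold m n π] : TopologicalSpace (Jet m n π) := (jetCore m n π).toTopologicalSpace
instance [FiberedManifold m n π] : ChartedSpace (JetModel m n) (Jet m n π) := (jetCore m n π).toChartedSpace

lemma isManifold_of_core {H : Type*} [NormedAddCommGroup H] [NormedSpace ℝ H] {N : Type*}
    (c : ChartedSpaceCore H N)
    (h : ∀ e e' : PartialEquiv N H, e ∈ c.atlas → e' ∈ c.atlas →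
      ContDiffOn ℝ ∞ (e.symm.trans e') (e.symm.trans e').source) :
    @IsManifold ℝ _ H _ _ H _ 𝓘(ℝ, H) ∞ N c.toTopologicalSpace c.toChartedSpace := by
  let := c.toTopologicalSpace
  let := c.toChartedSpace
  refine isManifold_of_contDiffOn 𝓘(ℝ, H) ∞ N ?_
  intro e e' he he'
  change e ∈ ⋃ (e : PartialEquiv N H) (he : e ∈ c.atlas), {c.openPartialHomeomorph e he} at he
  change e' ∈ ⋃ (e : PartialEquiv N H) (he : e ∈ c.atlas), {c.openPartialHomeomorph e he} at he'
  simp only [mem_iUnion, mem_singleton_iff] at he he'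
  obtain ⟨f, hf, rfl⟩ := he
  obtain ⟨f', hf', rfl⟩ := he'
  have := h f f' hf hf'
  simp only [modelWithCornersSelf_coe, modelWithCornersSelf_coe_symm, Function.id_comp,
    Function.comp_id, range_id, inter_univ, preimage_id]
  exact this

instance [FiberedManifold m n π] : IsManifold 𝓘(ℝ, JetModel m n) ∞ (Jet m n π) := by
  apply isManifold_of_core
  rintro _ _ ⟨a, rfl⟩ ⟨b, rfl⟩
  exact a.contDiffOn_jet b
end Jets
section VerticalForms

variable {V V' V'' B B' B'' : Type*}
  [AddCommGroup V] [Module ℝ V] [TopologicalSpace V] [AddCommGroup B] [Module ℝ B] [TopologicalSpace B]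
  [AddCommGroup V'] [Module ℝ V'] [TopologicalSpace V'] [AddCommGroup B'] [Module ℝ B'] [TopologicalSpace B']
  [AddCommGroup V''] [Module ℝ V''] [TopologicalSpace V''] [AddCommGroup B''] [Module ℝ B'']
  [TopologicalSpace B'']

/-- The `m`-forms on `V` which vanish when `r` of their arguments are `p`-vertical
(`Λ^m_r` for `p = T_uπ`). -/
def verticalForms (p : V →L[ℝ] B) (m r : ℕ) : Submodule ℝ (V [⋀^Fin m]→L[ℝ] ℝ) where
  carrier := {α | ∀ (v : Fin m → V) (s : Finset (Fin m)), s.card = r → (∀ i ∈ s, p (v i) = 0) → α v = 0}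
  add_mem' {α α'} h h' v s hs hv := by simp [h v s hs hv, h' v s hs hv]
  zero_mem' v s _ _ := by simp
  smul_mem' c α h v s hs hv := by simp [h v s hs hv]

/-- `Λ^m_2 / Λ^m_1`, as the image of `Λ^m_2` in the quotient of all `m`-forms by `Λ^m_1`. -/
def ReducedForms (p : V →L[ℝ] B) (m : ℕ) :
    Submodule ℝ ((V [⋀^Fin m]→L[ℝ] ℝ) ⧸ verticalForms p m 1) :=
  (verticalForms p m 2).map (verticalForms p m 1).mkQ

/-- The class of an element of `Λ^m_2`. -/
def reducedClass (p : V →L[ℝ] B) (m : ℕ) (α : verticalForms p m 2) : ReducedForms p m :=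
  ⟨(verticalForms p m 1).mkQ α.1, Submodule.mem_map_of_mem α.2⟩

lemma exists_reducedClass {p : V →L[ℝ] B} {m : ℕ} (k : ReducedForms p m) :
    ∃ α, reducedClass p m α = k := by
  obtain ⟨_, α, hα, rfl⟩ := k
  exact ⟨⟨α, hα⟩, rfl⟩

lemma reducedClass_eq {p : V →L[ℝ] B} {m : ℕ} {α β : verticalForms p m 2}
    (h : α.1 - β.1 ∈ verticalForms p m 1) : reducedClass p m α = reducedClass p m β :=
  Subtype.ext ((Submodule.Quotient.eq _).2 h)

lemma pull_mem {p : V →L[ℝ] B} {p' : V' →L[ℝ] B'} {m r : ℕ} {L : V →L[ℝ] V'}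
    (h : ∀ v, p v = 0 → p' (L v) = 0) {α : V' [⋀^Fin m]→L[ℝ] ℝ} (hα : α ∈ verticalForms p' m r) :
    α.compContinuousLinearMap L ∈ verticalForms p m r :=
  fun v s hs hv => hα (fun i => L (v i)) s hs fun i hi => h _ (hv i hi)

open Classical in
/-- Pull-back of classes by a linear map preserving vertical vectors. -/
def pullReduced (p : V →L[ℝ] B) (p' : V' →L[ℝ] B') (m : ℕ) (L : V →L[ℝ] V')
    (k : ReducedForms p' m) : ReducedForms p m :=
  if h : ∀ v, p v = 0 → p' (L v) = 0 then
    reducedClass p m ⟨(exists_reducedClass k).choose.1.compContinuousLinearMap L,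
      pull_mem h (exists_reducedClass k).choose.2⟩
  else 0

lemma pullReduced_mk {p : V →L[ℝ] B} {p' : V' →L[ℝ] B'} {m : ℕ} {L : V →L[ℝ] V'}
    (h : ∀ v, p v = 0 → p' (L v) = 0) (α : verticalForms p' m 2) :
    pullReduced p p' m L (reducedClass p' m α) =
      reducedClass p m ⟨α.1.compContinuousLinearMap L, pull_mem h α.2⟩ := by
  rw [pullReduced, dif_pos h]
  have h1 := (exists_reducedClass (reducedClass p' m α)).choose_spec
  have h2 := (Submodule.Quotient.eq _).1 (congrArg Subtype.val h1)
  exact reducedClass_eq (pull_mem h h2)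

lemma pullReduced_comp {p : V →L[ℝ] B} {p' : V' →L[ℝ] B'} {p'' : V'' →L[ℝ] B''} {m : ℕ}
    {L : V →L[ℝ] V'} {L' : V' →L[ℝ] V''}
    (h : ∀ v, p v = 0 → p' (L v) = 0) (h' : ∀ v, p' v = 0 → p'' (L' v) = 0) (k : ReducedForms p'' m) :
    pullReduced p p' m L (pullReduced p' p'' m L' k) = pullReduced p p'' m (L'.comp L) k := by
  obtain ⟨α, rfl⟩ := exists_reducedClass k
  have hc : ∀ v, p v = 0 → p'' ((L'.comp L) v) = 0 := fun v hv => h' _ (h v hv)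
  rw [pullReduced_mk h', pullReduced_mk h, pullReduced_mk hc]
  rfl

lemma pullReduced_id {p : V →L[ℝ] B} {m : ℕ} (k : ReducedForms p m) :
    pullReduced p p m (ContinuousLinearMap.id ℝ V) k = k := by
  obtain ⟨α, rfl⟩ := exists_reducedClass k
  rw [pullReduced_mk fun v hv => hv]
  rfl

end VerticalForms

variable (m n) in
/-- The projection `ℝ^m × ℝ^n → ℝ^m`. -/
abbrev modelProj : RSpace m × RSpace n →L[ℝ] RSpace m := ContinuousLinearMap.fst ℝ (RSpace m) (RSpace n)

variable (m n) in
lemma finiteDimensional_forms : FiniteDimensional ℝ ((RSpace m × RSpace n) [⋀^Fin m]→L[ℝ] ℝ) := by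
  let f : ((RSpace m × RSpace n) [⋀^Fin m]→L[ℝ] ℝ) →ₗ[ℝ]
      MultilinearMap ℝ (fun _ : Fin m => RSpace m × RSpace n) ℝ :=
    { toFun := fun α => α.toMultilinearMap
      map_add' := fun _ _ => rfl
      map_smul' := fun _ _ => rfl }
  refine FiniteDimensional.of_injective f fun α β h => ?_
  ext v
  exact congrArg (fun g : MultilinearMap ℝ (fun _ : Fin m => RSpace m × RSpace n) ℝ => g v) h

variable (m n) in
/-- The model fibre of `J¹π*`. -/
def MomentumModel : Type := ReducedForms (modelProj m n) m

instance : IsClosed ((verticalForms (modelProj m n) m 1 : Submodule ℝ _) :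
    Set ((RSpace m × RSpace n) [⋀^Fin m]→L[ℝ] ℝ)) := by
  have := finiteDimensional_forms m n
  exact Submodule.closed_of_finiteDimensional _

instance : NormedAddCommGroup (MomentumModel m n) :=
  inferInstanceAs (NormedAddCommGroup (ReducedForms (modelProj m n) m))

instance : NormedSpace ℝ (MomentumModel m n) where
  toModule := inferInstanceAs (Module ℝ (ReducedForms (modelProj m n) m))
  norm_smul_le c k := norm_smul_le c k.1

lemma exists_pull_formula : ∃ (s : MomentumModel m n →L[ℝ] (RSpace m × RSpace n) [⋀^Fin m]→L[ℝ] ℝ)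
    (q : ((RSpace m × RSpace n) [⋀^Fin m]→L[ℝ] ℝ) →L[ℝ] MomentumModel m n),
    ∀ (L : RSpace m × RSpace n →L[ℝ] RSpace m × RSpace n),
      (∀ v, modelProj m n v = 0 → modelProj m n (L v) = 0) → ∀ k : MomentumModel m n,
      (pullReduced (modelProj m n) (modelProj m n) m L k : MomentumModel m n) =
        q ((s k).compContinuousLinearMap L) := by
  have := finiteDimensional_forms m n
  let P2 := verticalForms (modelProj m n) m 2
  let Q : P2 →ₗ[ℝ] MomentumModel m n :=
    { toFun := reducedClass (modelProj m n) m
      map_add' := fun _ _ => rfl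
      map_smul' := fun _ _ => rfl }
  obtain ⟨S, hS⟩ := Q.exists_rightInverse_of_surjective
    (LinearMap.range_eq_top.2 fun k => exists_reducedClass k)
  have : FiniteDimensional ℝ P2 := FiniteDimensional.finiteDimensional_submodule P2
  have : FiniteDimensional ℝ (MomentumModel m n) :=
    Module.Finite.of_surjective Q fun k => exists_reducedClass k
  obtain ⟨q₀, hq₀⟩ := LinearMap.exists_extend Q
  let s₀ : MomentumModel m n →ₗ[ℝ] (RSpace m × RSpace n) [⋀^Fin m]→L[ℝ] ℝ := P2.subtype.comp S
  refine ⟨LinearMap.toContinuousLinearMap s₀, LinearMap.toContinuousLinearMap q₀, fun L hL k => ?_⟩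
  have hk : reducedClass (modelProj m n) m (S k) = k := LinearMap.congr_fun hS k
  have h1 := pullReduced_mk hL (S k)
  rw [hk] at h1
  refine h1.trans ?_
  exact (LinearMap.congr_fun hq₀ ⟨(S k).1.compContinuousLinearMap L, pull_mem hL (S k).2⟩).symm

variable (m n) in
lemma contDiff_compCLM :
    ContDiff ℝ ∞ (fun z : ((RSpace m × RSpace n) [⋀^Fin m]→L[ℝ] ℝ) ×
      (RSpace m × RSpace n →L[ℝ] RSpace m × RSpace n) => z.1.compContinuousLinearMap z.2) := by
  let CM := ContinuousMultilinearMap ℝ (fun _ : Fin m => RSpace m × RSpace n) ℝ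
  have hfd : FiniteDimensional ℝ CM := by
    let f : CM →ₗ[ℝ] MultilinearMap ℝ (fun _ : Fin m => RSpace m × RSpace n) ℝ :=
      { toFun := fun α => α.toMultilinearMap
        map_add' := fun _ _ => rfl
        map_smul' := fun _ _ => rfl }
    refine FiniteDimensional.of_injective f fun α β h => ?_
    ext v
    exact congrArg (fun g : MultilinearMap ℝ (fun _ : Fin m => RSpace m × RSpace n) ℝ => g v) h
  let i : ((RSpace m × RSpace n) [⋀^Fin m]→L[ℝ] ℝ) →L[ℝ] CM :=
    ContinuousAlternatingMap.toContinuousMultilinearMapCLM ℝ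
  obtain ⟨P, hP⟩ := LinearMap.exists_leftInverse_of_injective i.toLinearMap
    (LinearMap.ker_eq_bot.2 ContinuousAlternatingMap.toContinuousMultilinearMap_injective)
  have h1 : ContDiff ℝ ∞ (fun z : ((RSpace m × RSpace n) [⋀^Fin m]→L[ℝ] ℝ) ×
      (RSpace m × RSpace n →L[ℝ] RSpace m × RSpace n) =>
      ContinuousMultilinearMap.compContinuousLinearMapContinuousMultilinear ℝ
        (fun _ : Fin m => RSpace m × RSpace n) (fun _ => RSpace m × RSpace n) ℝ
        (fun _ => z.2) (i z.1)) := by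
    refine ContDiff.clm_apply ?_ (i.contDiff.comp contDiff_fst)
    exact (ContinuousMultilinearMap.contDiff _).comp (contDiff_pi.2 fun _ => contDiff_snd)
  have h2 := (LinearMap.toContinuousLinearMap P).contDiff.comp h1
  convert h2 using 1
  funext z
  exact (LinearMap.congr_fun hP (z.1.compContinuousLinearMap z.2)).symm

section DualJets

variable [IsManifold 𝓘(ℝ, RSpace m) ∞ M] [IsManifold 𝓘(ℝ, RSpace (m + n)) ∞ E]
  {π : E → M}

variable (m n π) in
/-- The restricted multimomentum bundle `J¹π* = Λ^m_2(T^*E) / Λ^m_1(T^*E)`. -/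
@[ext] structure DualJet where
  pt : E
  cls : ReducedForms (mfderiv 𝓘(ℝ, RSpace (m + n)) 𝓘(ℝ, RSpace m) π pt) m

variable (m n) in
/-- The model space of the coordinates `(x^i, u^α, p_α^i)` of `J¹π*`. -/
abbrev DualJetModel : Type := (RSpace m × RSpace n) × MomentumModel m n

lemma AdaptedChart.vert_chartD [FiberedManifold m n π] (a : AdaptedChart m n π) {u : E}
    (hu : u ∈ a.tot.source) (v : TangentSpace 𝓘(ℝ, RSpace (m + n)) u)
    (hv : mfderiv 𝓘(ℝ, RSpace (m + n)) 𝓘(ℝ, RSpace m) π u v = 0) :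
    modelProj m n (chartD (RSpace (m + n)) a.tot u v) = 0 := by
  have h1 := DFunLike.congr_fun (a.fst_comp (FiberedManifold.mdifferentiable π) hu) v
  refine h1.trans ?_
  rw [ContinuousLinearMap.comp_apply, hv, map_zero]

lemma AdaptedChart.vert_chartDinv [FiberedManifold m n π] (a : AdaptedChart m n π) {u : E}
    (hu : u ∈ a.tot.source) (w : RSpace m × RSpace n) (hw : modelProj m n w = 0) :
    mfderiv 𝓘(ℝ, RSpace (m + n)) 𝓘(ℝ, RSpace m) π u (chartDinv (RSpace (m + n)) a.tot u w) = 0 := by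
  have h1 := DFunLike.congr_fun (a.fst_comp (FiberedManifold.mdifferentiable π) hu)
    (chartDinv (RSpace (m + n)) a.tot u w)
  have h3 := DFunLike.congr_fun (a.smooth_tot.comp_inv hu) w
  have h2 := DFunLike.congr_fun (a.smooth_base.inv_comp (a.maps u hu))
    (mfderiv 𝓘(ℝ, RSpace (m + n)) 𝓘(ℝ, RSpace m) π u (chartDinv (RSpace (m + n)) a.tot u w))
  simp only [ContinuousLinearMap.comp_apply, ContinuousLinearMap.id_apply] at h1 h2 h3
  rw [h3] at h1
  rw [← h2, ← h1]
  exact (congrArg _ hw).trans (map_zero _)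

/-- The coordinates of an element of `J¹π*`. -/
def AdaptedChart.dualCoord (a : AdaptedChart m n π) (q : DualJet m n π) : DualJetModel m n :=
  (a.tot q.pt, pullReduced (modelProj m n) (mfderiv 𝓘(ℝ, RSpace (m + n)) 𝓘(ℝ, RSpace m) π q.pt) m
    (chartDinv (RSpace (m + n)) a.tot q.pt) q.cls)

/-- The element of `J¹π*` with given coordinates. -/
def AdaptedChart.dualOfCoord (a : AdaptedChart m n π) (z : DualJetModel m n) : DualJet m n π where
  pt := a.tot.symm z.1
  cls := pullReduced (mfderiv 𝓘(ℝ, RSpace (m + n)) 𝓘(ℝ, RSpace m) π (a.tot.symm z.1))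
    (modelProj m n) m (chartD (RSpace (m + n)) a.tot (a.tot.symm z.1)) z.2

/-- The chart of `J¹π*` induced by an adapted chart of `E`. -/
def AdaptedChart.dualChart [FiberedManifold m n π] (a : AdaptedChart m n π) :
    PartialEquiv (DualJet m n π) (DualJetModel m n) where
  toFun := a.dualCoord
  invFun := a.dualOfCoord
  source := {q | q.pt ∈ a.tot.source}
  target := {z | z.1 ∈ a.tot.target}
  map_source' q hq := a.tot.map_source hq
  map_target' z hz := a.tot.map_target hz
  left_inv' := by
    rintro ⟨u, k⟩ (hu : u ∈ a.tot.source)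
    have key := pullReduced_comp (m := m) (a.vert_chartD hu) (a.vert_chartDinv hu) k
    rw [a.smooth_tot.inv_comp hu, pullReduced_id] at key
    have : ∀ u' (_ : u' = u), (⟨u', pullReduced (mfderiv 𝓘(ℝ, RSpace (m + n)) 𝓘(ℝ, RSpace m) π u')
        (modelProj m n) m (chartD (RSpace (m + n)) a.tot u') (a.dualCoord ⟨u, k⟩).2⟩ :
        DualJet m n π) = ⟨u, k⟩ := by
      rintro u' rfl
      exact congrArg _ key
    exact this _ (a.tot.left_inv hu)
  right_inv' := by
    rintro ⟨z, k⟩ (hz : z ∈ a.tot.target)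
    have hu : a.tot.symm z ∈ a.tot.source := a.tot.map_target hz
    refine Prod.ext (a.tot.right_inv hz) ?_
    have key := pullReduced_comp (m := m) (a.vert_chartDinv hu) (a.vert_chartD hu) k
    rw [a.smooth_tot.comp_inv hu] at key
    exact key.trans (pullReduced_id _)

lemma AdaptedChart.dualChart_trans_source [FiberedManifold m n π] (a b : AdaptedChart m n π) :
    (a.dualChart.symm.trans b.dualChart).source =
      (a.tot.target ∩ a.tot.symm ⁻¹' b.tot.source) ×ˢ univ := by
  ext z
  have : (a.dualChart.symm.trans b.dualChart).source =
    {z | z.1 ∈ a.tot.target ∧ a.tot.symm z.1 ∈ b.tot.source} := rfl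
  rw [this]
  simp

lemma AdaptedChart.contDiffOn_dual [FiberedManifold m n π] (a b : AdaptedChart m n π) :
    ContDiffOn ℝ ∞ (a.dualChart.symm.trans b.dualChart)
      (a.dualChart.symm.trans b.dualChart).source := by
  rw [a.dualChart_trans_source b]
  obtain ⟨s, q, hsq⟩ := exists_pull_formula (m := m) (n := n)
  set S := a.tot.target ∩ a.tot.symm ⁻¹' b.tot.source with hS
  set τ := b.tot ∘ a.tot.symm with hτ
  have hτs : ContDiffOn ℝ ∞ τ S := transition_contDiffOn a.smooth_tot b.smooth_tot
  set S' := b.tot.target ∩ b.tot.symm ⁻¹' a.tot.source with hS'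
  have hSo' : IsOpen S' := transition_isOpen
  set σ := a.tot ∘ b.tot.symm with hσ
  have hσs : ContDiffOn ℝ ∞ σ S' := transition_contDiffOn b.smooth_tot a.smooth_tot
  have hmaps : MapsTo τ S S' := by
    rintro z ⟨hz, hz'⟩
    simp only [hτ, Function.comp, hS', mem_inter_iff, mem_preimage]
    exact ⟨b.tot.map_source hz', by rw [b.tot.left_inv hz']; exact a.tot.map_target hz⟩
  have hform : EqOn (a.dualChart.symm.trans b.dualChart)
      (fun z => (τ z.1, q ((s z.2).compContinuousLinearMap (fderiv ℝ σ (τ z.1))))) (S ×ˢ univ) := by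
    rintro ⟨z, k⟩ ⟨⟨hz, hz'⟩, -⟩
    have hu : a.tot.symm z ∈ a.tot.source := a.tot.map_target hz
    refine Prod.ext rfl ?_
    have t1 := chartD_transition b.smooth_tot a.smooth_tot hz' hu
    have key := pullReduced_comp (m := m) (b.vert_chartDinv hz') (a.vert_chartD hu) k
    refine key.trans ((hsq _ ?_ k).trans ?_)
    · exact fun v hv => a.vert_chartD hu _ (b.vert_chartDinv hz' v hv)
    · rw [t1]; rfl
  refine ContDiffOn.congr ?_ hform
  have hfst : ContDiffOn ℝ ∞ (fun z : DualJetModel m n => z.1) (S ×ˢ univ) := contDiff_fst.contDiffOn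
  have m1 : MapsTo (fun z : DualJetModel m n => z.1) (S ×ˢ univ) S := fun z hz => hz.1
  have c1 : ContDiffOn ℝ ∞ (fun z : DualJetModel m n => τ z.1) (S ×ˢ univ) := hτs.comp hfst m1
  have c2 : ContDiffOn ℝ ∞ (fun z : DualJetModel m n => fderiv ℝ σ (τ z.1)) (S ×ˢ univ) :=
    (hσs.fderiv_of_isOpen hSo' (m := ∞) (by simp)).comp c1 (fun z hz => hmaps hz.1)
  have c3 : ContDiffOn ℝ ∞ (fun z : DualJetModel m n => s z.2) (S ×ˢ univ) :=
    (s.contDiff.comp contDiff_snd).contDiffOn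
  exact c1.prodMk (q.contDiff.comp_contDiffOn ((contDiff_compCLM m n).comp_contDiffOn (c3.prodMk c2)))

variable (m n π) in
/-- The smooth atlas of `J¹π*` given by the induced charts. -/
def dualCore [FiberedManifold m n π] : ChartedSpaceCore (DualJetModel m n) (DualJet m n π) where
  atlas := range AdaptedChart.dualChart
  chartAt q := (chartNear m n π q.pt).dualChart
  mem_chart_source q := mem_chartNear (m := m) (n := n) q.pt
  chart_mem_atlas q := ⟨_, rfl⟩
  open_source := by
    rintro _ _ ⟨a, rfl⟩ ⟨b, rfl⟩
    rw [a.dualChart_trans_source b]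
    exact transition_isOpen.prod isOpen_univ
  continuousOn_toFun := by
    rintro _ _ ⟨a, rfl⟩ ⟨b, rfl⟩
    exact (a.contDiffOn_dual b).continuousOn

instance [FiberedManifold m n π] : TopologicalSpace (DualJet m n π) :=
  (dualCore m n π).toTopologicalSpace
instance [FiberedManifold m n π] : ChartedSpace (DualJetModel m n) (DualJet m n π) :=
  (dualCore m n π).toChartedSpace

instance [FiberedManifold m n π] : IsManifold 𝓘(ℝ, DualJetModel m n) ∞ (DualJet m n π) := by
  apply isManifold_of_core
  rintro _ _ ⟨a, rfl⟩ ⟨b, rfl⟩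
  exact a.contDiffOn_dual b
end DualJets
section Distributions

variable {H : Type*} [NormedAddCommGroup H] [NormedSpace ℝ H]
  {N : Type*} [TopologicalSpace N] [ChartedSpace H N]

/-- `X` is a smooth vector field on the open set `V`. -/
def IsSmoothVectorFieldOn [IsManifold 𝓘(ℝ, H) ∞ N] (X : ∀ p : N, TangentSpace 𝓘(ℝ, H) p)
    (V : Set N) : Prop :=
  ContMDiffOn 𝓘(ℝ, H) 𝓘(ℝ, H).tangent ∞ (fun p => (⟨p, X p⟩ : TangentBundle 𝓘(ℝ, H) N)) V

/-- A smooth distribution of rank `k`, i.e. a rank `k` smooth vector subbundle of `TN`: locally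
spanned by `k` linearly independent smooth vector fields. -/
def IsSmoothDistribution [IsManifold 𝓘(ℝ, H) ∞ N] (k : ℕ)
    (D : ∀ p : N, Submodule ℝ (TangentSpace 𝓘(ℝ, H) p)) : Prop :=
  ∀ p : N, ∃ V : Set N, IsOpen V ∧ p ∈ V ∧
    ∃ Z : Fin k → ∀ q : N, TangentSpace 𝓘(ℝ, H) q,
      (∀ i, IsSmoothVectorFieldOn (Z i) V) ∧
      ∀ q ∈ V, LinearIndependent ℝ (fun i => Z i q) ∧
        Submodule.span ℝ (range fun i => Z i q) = D q

/-- `D` is transverse to the projection `ρ : N → M`: it contains no nonzero `ρ`-vertical vector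
(for `rank D = dim M` this says that `Tρ` maps `D p` isomorphically onto the tangent space). -/
def IsTransverse (ρ : N → M) (D : ∀ p : N, Submodule ℝ (TangentSpace 𝓘(ℝ, H) p)) : Prop :=
  ∀ p : N, ∀ w ∈ D p, mfderiv 𝓘(ℝ, H) 𝓘(ℝ, RSpace m) ρ p w = 0 → w = 0

/-- `ψ` is a smooth local section of `ρ : N → M` with open domain `U`. -/
structure IsLocalSection (ρ : N → M) (U : Set M) (ψ : M → N) : Prop where
  isOpen : IsOpen U
  smooth : ContMDiffOn 𝓘(ℝ, RSpace m) 𝓘(ℝ, H) ∞ ψ U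
  right_inv : ∀ x ∈ U, ρ (ψ x) = x

/-- `ψ` is a local integral section of `D` over `U`: at each point of its image, the tangent space
of the image is the subspace given by `D`. -/
structure IsIntegralSection (ρ : N → M) (D : ∀ p : N, Submodule ℝ (TangentSpace 𝓘(ℝ, H) p))
    (U : Set M) (ψ : M → N) : Prop extends
    IsLocalSection (m := m) (H := H) ρ U ψ where
  tangent : ∀ x ∈ U, (mfderiv 𝓘(ℝ, RSpace m) 𝓘(ℝ, H) ψ x).range = D (ψ x)

/-- Integrability of a distribution `D` of rank `dim M` transverse to `ρ : N → M`: there is an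
integral manifold through every point. By transversality the integral manifolds are, locally,
the images of the integral sections. -/
def IsIntegrable (ρ : N → M) (D : ∀ p : N, Submodule ℝ (TangentSpace 𝓘(ℝ, H) p)) : Prop :=
  ∀ p : N, ∃ (U : Set M) (ψ : M → N),
    ρ p ∈ U ∧ ψ (ρ p) = p ∧ IsIntegralSection (m := m) ρ D U ψ

/-- The local section `ψ` over `U` has boundary conditions in `S`: either it takes a value
in `S` somewhere in `U` (data prescribed inside the domain, e.g. on a hypersurface), or it extends
continuously to a nonempty relatively open part `O ∩ ∂U` of the boundary of `U`, with
boundary values in `S`. -/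
def HasBoundaryConditionsIn (U : Set M) (ψ : M → N) (S : Set N) : Prop :=
  (∃ x ∈ U, ψ x ∈ S) ∨
  ∃ O : Set M, IsOpen O ∧ (O ∩ frontier U).Nonempty ∧ ContinuousOn ψ (U ∪ (O ∩ frontier U)) ∧
    MapsTo ψ (O ∩ frontier U) S

end Distributions

section DifferentialForms

variable {H : Type*} [NormedAddCommGroup H] [NormedSpace ℝ H]
  {N : Type*} [TopologicalSpace N] [ChartedSpace H N] {k : ℕ}

/-- The expression of a `k`-form on `N` in the preferred chart at `p`. -/
def formInChart (ξ : ∀ p : N, TangentSpace 𝓘(ℝ, H) p [⋀^Fin k]→L[ℝ] ℝ) (p : N) :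
    H → H [⋀^Fin k]→L[ℝ] ℝ := fun z =>
  (ξ ((chartAt H p).symm z)).compContinuousLinearMap
    (mfderiv 𝓘(ℝ, H) 𝓘(ℝ, H) (chartAt H p).symm z)

/-- Smooth `k`-forms. -/
def IsSmoothForm (ξ : ∀ p : N, TangentSpace 𝓘(ℝ, H) p [⋀^Fin k]→L[ℝ] ℝ) : Prop :=
  ∀ p : N, ContDiffOn ℝ ∞ (formInChart ξ p) (chartAt H p).target

/-- The exterior derivative of a `k`-form on a manifold, computed in charts. -/
def exteriorDerivative (ξ : ∀ p : N, TangentSpace 𝓘(ℝ, H) p [⋀^Fin k]→L[ℝ] ℝ) (p : N) :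
    TangentSpace 𝓘(ℝ, H) p [⋀^Fin (k + 1)]→L[ℝ] ℝ :=
  (extDeriv (formInChart ξ p) (chartAt H p p)).compContinuousLinearMap
    (mfderiv 𝓘(ℝ, H) 𝓘(ℝ, H) (chartAt H p) p)

/-- A volume form on `M`: a smooth nowhere vanishing form of top degree. -/
structure IsVolumeForm (η : ∀ x : M, TangentSpace 𝓘(ℝ, RSpace m) x [⋀^Fin m]→L[ℝ] ℝ) : Prop where
  smooth : IsSmoothForm η
  ne_zero : ∀ x, η x ≠ 0

/-- The field equation `ψ^*(i(X)Ω) = 0` on `U`, for every vector field `X` on `N`, where `Ω` is an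
`(m+1)`-form on `N` and `ψ` is a local section over `U`. -/
def SolvesFieldEquation [IsManifold 𝓘(ℝ, H) ∞ N]
    (Ω : ∀ p : N, TangentSpace 𝓘(ℝ, H) p [⋀^Fin (m + 1)]→L[ℝ] ℝ) (U : Set M) (ψ : M → N) : Prop :=
  ∀ X : ∀ p : N, TangentSpace 𝓘(ℝ, H) p, IsSmoothVectorFieldOn X univ →
    ∀ x ∈ U, ∀ v : Fin m → TangentSpace 𝓘(ℝ, RSpace m) x,
      Ω (ψ x) (Matrix.vecCons (X (ψ x))
        (fun i => mfderiv 𝓘(ℝ, RSpace m) 𝓘(ℝ, H) ψ x (v i))) = 0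

variable {V W : Type*} [AddCommGroup V] [Module ℝ V] [TopologicalSpace V]
  [AddCommGroup W] [Module ℝ W] [TopologicalSpace W]

/-- The form `(w₁, …, w_k) ↦ ∑ i, β (S w₁, …, T wᵢ, …, S w_k)`. If `T = ∑ θ^α ⊗ P_α` then this is
`∑ θ^α ∧ S^*(i(P_α)β)`. -/
def insertForm (S T : V →L[ℝ] W) (β : W [⋀^Fin k]→L[ℝ] ℝ) : V [⋀^Fin k]→L[ℝ] ℝ where
  toContinuousMultilinearMap := ∑ i : Fin k,
    β.toContinuousMultilinearMap.compContinuousLinearMap (fun l => if l = i then T else S)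
  map_eq_zero_of_eq' := by
    intro w a b hw hab
    have hsum : (∑ i : Fin k, β.toContinuousMultilinearMap.compContinuousLinearMap
        (fun l => if l = i then T else S)) w =
        ∑ i : Fin k, β (fun l => (if l = i then T else S) (w l)) :=
      sum_apply _ _ w
    refine hsum.trans ?_
    rw [Finset.sum_eq_add a b hab]
    · have hswap := β.toAlternatingMap.map_swap (fun l => (if l = a then T else S) (w l)) hab
      have hfun : (fun l => (if l = a then T else S) (w l)) ∘ Equiv.swap a b =
          fun l => (if l = b then T else S) (w l) := by
        funext l
        by_cases h1 : l = a
        · subst h1; simp [hab, hab.symm, hw]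
        by_cases h2 : l = b
        · subst h2; simp [hw]
        · simp [Equiv.swap_apply_of_ne_of_ne h1 h2, h1, h2]
      rw [hfun] at hswap
      refine (congrArg (fun t => β (fun l => (if l = a then T else S) (w l)) + t) hswap).trans ?_
      exact add_neg_cancel _
    · intro i _ hi
      refine β.map_eq_zero_of_eq _ (i := a) (j := b) ?_ hab
      simp [hi.1.symm, hi.2.symm, hw]
    · simp
    · simp

end DifferentialForms

section Lagrangian

variable [IsManifold 𝓘(ℝ, RSpace m) ∞ M] [IsManifold 𝓘(ℝ, RSpace (m + n)) ∞ E]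
  {π : E → M} [FiberedManifold m n π]

/-- The projection `π¹ : J¹π → E`. -/
def jetProj (j : Jet m n π) : E := j.pt

/-- The projection `π̄¹ = π ∘ π¹ : J¹π → M`. -/
def jetBase (j : Jet m n π) : M := π j.pt

/-- The tangent map `T_jπ¹`. -/
def tangentJetProj (j : Jet m n π) :
    TangentSpace 𝓘(ℝ, JetModel m n) j →L[ℝ] TangentSpace 𝓘(ℝ, RSpace (m + n)) j.pt :=
  mfderiv 𝓘(ℝ, JetModel m n) 𝓘(ℝ, RSpace (m + n)) (jetProj : Jet m n π → E) j

/-- The tangent map `T_jπ̄¹`. -/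
def tangentJetBase (j : Jet m n π) :
    TangentSpace 𝓘(ℝ, JetModel m n) j →L[ℝ] TangentSpace 𝓘(ℝ, RSpace m) (π j.pt) :=
  mfderiv 𝓘(ℝ, JetModel m n) 𝓘(ℝ, RSpace m) (jetBase : Jet m n π → M) j

/-- The contact (structure) form of `J¹π` at `j = (u, A)`: the vertical-valued `1`-form
`w ↦ Tπ¹ w - A (Tπ̄¹ w)`, in coordinates `(d u^α - u_i^α d x^i) ⊗ ∂/∂u^α`. -/
def contactForm (j : Jet m n π) :
    TangentSpace 𝓘(ℝ, JetModel m n) j →L[ℝ] TangentSpace 𝓘(ℝ, RSpace (m + n)) j.pt :=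
  tangentJetProj j - j.lin.1.comp (tangentJetBase j)

/-- The fibre derivative of `L` at `j` in the direction `d x^i ⊗ y`, i.e. `y ↦ y^α ∂L/∂u_i^α (j)`, in
the bundle coordinates of `J¹π` at `j`. -/
def fiberDerivative (L : Jet m n π → ℝ) (j : Jet m n π) (i : Fin m) : RSpace n →L[ℝ] ℝ :=
  (mfderiv 𝓘(ℝ, JetModel m n) 𝓘(ℝ, ℝ) L j).comp
    ((chartDinv (JetModel m n) (chartAt (JetModel m n) j) j).comp
      ((ContinuousLinearMap.inr ℝ (RSpace m × RSpace n) (RSpace m →L[ℝ] RSpace n)).comp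
        (ContinuousLinearMap.smulRightL ℝ (RSpace m) (RSpace n)
          (EuclideanSpace.proj i : RSpace m →L[ℝ] ℝ))))

/-- The endomorphism-type tensor `∑ i, (∂L/∂u_i^α θ^α) ⊗ ∂/∂x^i` at `j`, where `θ^α` are the
components of the contact form. It does not depend on the adapted coordinates. -/
def legendreTensor (L : Jet m n π → ℝ) (j : Jet m n π) :
    TangentSpace 𝓘(ℝ, JetModel m n) j →L[ℝ] TangentSpace 𝓘(ℝ, RSpace m) (π j.pt) :=
  ∑ i : Fin m, ((fiberDerivative L j i).comp
    ((ContinuousLinearMap.snd ℝ (RSpace m) (RSpace n)).comp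
      ((chartD (RSpace (m + n)) (chartNear m n π j.pt).tot j.pt).comp
        (contactForm j)))).smulRight
      (chartDinv (RSpace m) (chartNear m n π j.pt).base (π j.pt) (EuclideanSpace.single i 1))

/-- The Poincaré–Cartan `m`-form `Θ_𝓛 = ∂L/∂u_i^α θ^α ∧ i(∂/∂x^i)η + L η` of the Lagrangian
density `𝓛 = L η`, where `θ^α = d u^α - u_i^α d x^i`. -/
def cartanForm (η : ∀ x : M, TangentSpace 𝓘(ℝ, RSpace m) x [⋀^Fin m]→L[ℝ] ℝ)
    (L : Jet m n π → ℝ) (j : Jet m n π) :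
    TangentSpace 𝓘(ℝ, JetModel m n) j [⋀^Fin m]→L[ℝ] ℝ :=
  L j • (η (π j.pt)).compContinuousLinearMap (tangentJetBase j) +
    insertForm (tangentJetBase j) (legendreTensor L j) (η (π j.pt))

/-- The Poincaré–Cartan `(m+1)`-form `Ω_𝓛 = -dΘ_𝓛`. -/
def cartanMultisymplecticForm (η : ∀ x : M, TangentSpace 𝓘(ℝ, RSpace m) x [⋀^Fin m]→L[ℝ] ℝ)
    (L : Jet m n π → ℝ) (j : Jet m n π) :
    TangentSpace 𝓘(ℝ, JetModel m n) j [⋀^Fin (m + 1)]→L[ℝ] ℝ :=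
  -exteriorDerivative (cartanForm η L) j

/-- `A` is the `1`-jet at `x` of the local section `φ`, i.e. `A = T_x φ` (stated as
`A ∘ T_x(π ∘ φ) = T_x φ`, where `π ∘ φ` is the identity near `x`). -/
def IsJetAt (φ : M → E) (x : M) (A : JetFiber m n π (φ x)) : Prop :=
  A.1.comp (mfderiv 𝓘(ℝ, RSpace m) 𝓘(ℝ, RSpace m) (fun y => π (φ y)) x) =
    mfderiv 𝓘(ℝ, RSpace m) 𝓘(ℝ, RSpace (m + n)) φ x

/-- `ψ = j¹φ` on `U`. -/
def IsProlongation (U : Set M) (φ : M → E) (ψ : M → Jet m n π) : Prop :=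
  ∀ x ∈ U, ∃ A : JetFiber m n π (φ x), IsJetAt φ x A ∧ ψ x = ⟨φ x, A⟩

/-- `D` is a solution of the Lagrangian problem of the Lagrangian density `L η`: an `m`-dimensional,
`π̄¹`-transverse and integrable distribution in `J¹π` whose integral sections are holonomic and
satisfy `ψ^* i(X)Ω_𝓛 = 0` for every vector field `X` on `J¹π`. -/
structure SolvesLagrangianProblem
    (η : ∀ x : M, TangentSpace 𝓘(ℝ, RSpace m) x [⋀^Fin m]→L[ℝ] ℝ) (L : Jet m n π → ℝ)
    (D : ∀ j : Jet m n π, Submodule ℝ (TangentSpace 𝓘(ℝ, JetModel m n) j)) : Prop where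
  isSmooth : IsSmoothDistribution m D
  isTransverse : IsTransverse (m := m) (jetBase : Jet m n π → M) D
  isIntegrable : IsIntegrable (m := m) (jetBase : Jet m n π → M) D
  holonomic : ∀ (U : Set M) (ψ : M → Jet m n π), IsIntegralSection (m := m) jetBase D U ψ →
    ∃ φ : M → E, IsLocalSection (m := m) (H := RSpace (m + n)) π U φ ∧ IsProlongation U φ ψ
  fieldEquation : ∀ (U : Set M) (ψ : M → Jet m n π), IsIntegralSection (m := m) jetBase D U ψ →
    SolvesFieldEquation (cartanMultisymplecticForm η L) U ψ

/-- The section `u ↦ (u, Ψ u)` of `π¹ : J¹π → E` given by a field of `1`-jets. -/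
def jetLift (Ψ : ∀ u : E, JetFiber m n π u) (u : E) : Jet m n π := ⟨u, Ψ u⟩

/-- `Ψ` is a jet field, i.e. a smooth section of `π¹`. -/
def IsSmoothJetField (Ψ : ∀ u : E, JetFiber m n π u) : Prop :=
  ContMDiff 𝓘(ℝ, RSpace (m + n)) 𝓘(ℝ, JetModel m n) ∞ (jetLift Ψ)

/-- The jet field `Ψ` is integrable: through every point there is a local section `γ` of `π` with
`j¹γ = Ψ ∘ γ`. -/
def IsIntegrableJetField (Ψ : ∀ u : E, JetFiber m n π u) : Prop :=
  ∀ u : E, ∃ (U : Set M) (γ : M → E), IsLocalSection (m := m) (H := RSpace (m + n)) π U γ ∧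
    π u ∈ U ∧ γ (π u) = u ∧ ∀ x ∈ U, IsJetAt γ x (Ψ (γ x))

/-- The distribution `Tπ¹(D|_{Im Ψ})` in `E`. -/
def jetProjected (D : ∀ j : Jet m n π, Submodule ℝ (TangentSpace 𝓘(ℝ, JetModel m n) j))
    (Ψ : ∀ u : E, JetFiber m n π u) (u : E) :
    Submodule ℝ (TangentSpace 𝓘(ℝ, RSpace (m + n)) u) :=
  (D ⟨u, Ψ u⟩).map (tangentJetProj (⟨u, Ψ u⟩ : Jet m n π)).toLinearMap

/-- `Ψ` is a solution of the generalized Lagrangian Hamilton–Jacobi problem for `D = D_𝓛`: it is an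
integrable jet field and, for every integral section `γ` of `Tπ¹(D|_{Im Ψ})`, the section `Ψ ∘ γ` is
an integral section of `D`. (That `Tπ¹(D|_{Im Ψ})` is an integrable distribution of rank `m` is
automatic: as integral sections of `D_𝓛` are holonomic, it is the one defined by `Ψ`.) -/
structure SolvesGeneralizedLagrangianHJ
    (D : ∀ j : Jet m n π, Submodule ℝ (TangentSpace 𝓘(ℝ, JetModel m n) j))
    (Ψ : ∀ u : E, JetFiber m n π u) : Prop where
  isSmooth : IsSmoothJetField Ψ
  isIntegrable : IsIntegrableJetField Ψ
  lifts : ∀ (U : Set M) (γ : M → E), IsIntegralSection (m := m) π (jetProjected D Ψ) U γ →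
    IsIntegralSection (m := m) jetBase D U (jetLift Ψ ∘ γ)

end Lagrangian

section Hamiltonian

variable [IsManifold 𝓘(ℝ, RSpace m) ∞ M] [IsManifold 𝓘(ℝ, RSpace (m + n)) ∞ E]
  {π : E → M} [FiberedManifold m n π]

/-- The projection `π_E^r : J¹π* → E`. -/
def dualProj (q : DualJet m n π) : E := q.pt

/-- The tangent map `T_qπ_E^r`. -/
def tangentDualProj (q : DualJet m n π) :
    TangentSpace 𝓘(ℝ, DualJetModel m n) q →L[ℝ] TangentSpace 𝓘(ℝ, RSpace (m + n)) q.pt :=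
  mfderiv 𝓘(ℝ, DualJetModel m n) 𝓘(ℝ, RSpace (m + n)) (dualProj : DualJet m n π → E) q

/-- The projection `π̄_E^r : J¹π* → M`. -/
def dualBase (q : DualJet m n π) : M := π q.pt

variable (m n π) in
/-- A Hamiltonian section, i.e. a smooth section `h` of `μ : Λ^m_2(T^*E) → J¹π^*`: a choice of
a representative `h q ∈ Λ^m_2(T^*_u E)` of each class `q` over `u`, such that in adapted coordinates
the function `-H(q) = h(q)(∂/∂x^1, …, ∂/∂x^m)` is smooth. -/
structure HamiltonianSection where
  form : ∀ q : DualJet m n π,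
    verticalForms (mfderiv 𝓘(ℝ, RSpace (m + n)) 𝓘(ℝ, RSpace m) π q.pt) m 2
  isSection : ∀ q : DualJet m n π,
    reducedClass (mfderiv 𝓘(ℝ, RSpace (m + n)) 𝓘(ℝ, RSpace m) π q.pt) m (form q) = q.cls
  smooth : ∀ a : AdaptedChart m n π,
    ContMDiffOn 𝓘(ℝ, DualJetModel m n) 𝓘(ℝ, ℝ) ∞
      (fun q : DualJet m n π => (form q).1 (fun i =>
        chartDinv (RSpace (m + n)) a.tot q.pt (EuclideanSpace.single i 1, 0)))
      {q | q.pt ∈ a.tot.source}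

/-- The Hamilton–Cartan `m`-form `Θ_h = h^*Θ`, where `Θ` is the tautological form of `Λ^m_2(T^*E)`,
i.e. `Θ_h(q) = (π_E^r)^*(h q)`. -/
def hamiltonCartanForm (h : HamiltonianSection m n π) (q : DualJet m n π) :
    TangentSpace 𝓘(ℝ, DualJetModel m n) q [⋀^Fin m]→L[ℝ] ℝ :=
  (h.form q).1.compContinuousLinearMap (tangentDualProj q)

/-- The Hamilton–Cartan `(m+1)`-form `Ω_h = h^*Ω = -dΘ_h`. -/
def hamiltonMultisymplecticForm (h : HamiltonianSection m n π) (q : DualJet m n π) :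
    TangentSpace 𝓘(ℝ, DualJetModel m n) q [⋀^Fin (m + 1)]→L[ℝ] ℝ :=
  -exteriorDerivative (hamiltonCartanForm h) q

/-- `D` is a solution of the Hamiltonian problem of the Hamiltonian section `h`: an `m`-dimensional,
`π̄_E^r`-transverse and integrable distribution in `J¹π*` whose integral sections satisfy
`ψ^* i(X)Ω_h = 0` for every vector field `X` on `J¹π*`. -/
structure SolvesHamiltonianProblem (h : HamiltonianSection m n π)
    (D : ∀ q : DualJet m n π, Submodule ℝ (TangentSpace 𝓘(ℝ, DualJetModel m n) q)) : Prop where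
  isSmooth : IsSmoothDistribution m D
  isTransverse : IsTransverse (m := m) (dualBase : DualJet m n π → M) D
  isIntegrable : IsIntegrable (m := m) (dualBase : DualJet m n π → M) D
  fieldEquation : ∀ (U : Set M) (ψ : M → DualJet m n π), IsIntegralSection (m := m) dualBase D U ψ →
    SolvesFieldEquation (hamiltonMultisymplecticForm h) U ψ

/-- The section `u ↦ (u, s u)` of `π_E^r : J¹π* → E` given by a field of reduced forms. -/
def dualLift (s : ∀ u : E, ReducedForms (mfderiv 𝓘(ℝ, RSpace (m + n)) 𝓘(ℝ, RSpace m) π u) m)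
    (u : E) : DualJet m n π := ⟨u, s u⟩

/-- The distribution `Tπ_E^r(D|_{Im s})` in `E`. -/
def dualProjected (D : ∀ q : DualJet m n π, Submodule ℝ (TangentSpace 𝓘(ℝ, DualJetModel m n) q))
    (s : ∀ u : E, ReducedForms (mfderiv 𝓘(ℝ, RSpace (m + n)) 𝓘(ℝ, RSpace m) π u) m) (u : E) :
    Submodule ℝ (TangentSpace 𝓘(ℝ, RSpace (m + n)) u) :=
  (D ⟨u, s u⟩).map (tangentDualProj (⟨u, s u⟩ : DualJet m n π)).toLinearMap

/-- `s` is a solution of the generalized Hamiltonian Hamilton–Jacobi problem for `D = D_h`: it is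
a smooth section of `π_E^r` for which `Tπ_E^r(D|_{Im s})` is integrable and, for every integral
section `γ` of this distribution, `s ∘ γ` is an integral section of `D`. -/
structure SolvesGeneralizedHamiltonianHJ
    (D : ∀ q : DualJet m n π, Submodule ℝ (TangentSpace 𝓘(ℝ, DualJetModel m n) q))
    (s : ∀ u : E, ReducedForms (mfderiv 𝓘(ℝ, RSpace (m + n)) 𝓘(ℝ, RSpace m) π u) m) : Prop where
  isSmooth : ContMDiff 𝓘(ℝ, RSpace (m + n)) 𝓘(ℝ, DualJetModel m n) ∞ (dualLift s)
  isIntegrable : IsIntegrable (m := m) π (dualProjected D s)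
  lifts : ∀ (U : Set M) (γ : M → E), IsIntegralSection (m := m) π (dualProjected D s) U γ →
    IsIntegralSection (m := m) dualBase D U (dualLift s ∘ γ)

end Hamiltonian
end FieldTheory
end

/-!
Over a coordinate line of `M`, curves tangent to a transverse distribution are integral curves of a
`C¹` vector field, so by uniqueness for ordinary differential equations two integral sections that
agree at a point of the line agree further along it. The image of a solution of the Hamilton–Jacobi
problem is foliated by the integral sections `Ψ ∘ γ`, and it is closed because the points of a fibre
over `E` can be separated; hence an integral section that meets the image over a connected domain
stays in it. Boundary data are carried into the domain by the same uniqueness argument, which needs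
only one-sided continuity at the initial time: it starts at the last time at which a coordinate
segment from a boundary point to a nearby point of the domain lies outside the domain.
-/

noncomputable section
namespace FieldTheory

section LinearAlgebra

lemma isInvertible_of_injective {V : Type*} [AddCommGroup V] [Module ℝ V] [TopologicalSpace V]
    [IsTopologicalAddGroup V] [ContinuousSMul ℝ V] [T2Space V] [FiniteDimensional ℝ V]
    {f : V →L[ℝ] V} (hf : Function.Injective f) : f.IsInvertible :=
  ⟨(LinearEquiv.ofInjectiveEndo (f : V →ₗ[ℝ] V) hf).toContinuousLinearEquiv, by ext; rfl⟩

variable {k : ℕ} {V : Type*} [AddCommGroup V] [Module ℝ V] [TopologicalSpace V]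
  [IsTopologicalAddGroup V] [ContinuousSMul ℝ V]

/-- The linear map `ℝ^k → V` which sends the standard basis to the vectors `Z i`: it is an
isomorphism onto their span when `Z` is a frame. -/
def frameMap (Z : Fin k → V) : RSpace k →L[ℝ] V :=
  ∑ i, (EuclideanSpace.proj i : RSpace k →L[ℝ] ℝ).smulRight (Z i)

lemma frameMap_apply (Z : Fin k → V) (a : RSpace k) : frameMap Z a = ∑ i, a i • Z i := by
  simp [frameMap]

lemma mem_span_range_iff_exists_frameMap {Z : Fin k → V} {w : V} :
    w ∈ Submodule.span ℝ (range Z) ↔ ∃ a, frameMap Z a = w := by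
  rw [Submodule.mem_span_range_iff_exists_fun]
  refine ⟨fun ⟨c, hc⟩ => ⟨WithLp.toLp 2 c, ?_⟩, fun ⟨a, ha⟩ => ⟨a, ?_⟩⟩
  · rw [frameMap_apply, ← hc]
  · rw [← ha, frameMap_apply]

lemma frameMap_injective {Z : Fin k → V} (hZ : LinearIndependent ℝ Z) :
    Function.Injective (frameMap Z) := by
  refine (injective_iff_map_eq_zero _).2 fun a ha => ?_
  rw [frameMap_apply] at ha
  ext i
  exact Fintype.linearIndependent_iff.1 hZ a ha i

lemma frameMap_comp {V' : Type*} [AddCommGroup V'] [Module ℝ V'] [TopologicalSpace V']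
    [IsTopologicalAddGroup V'] [ContinuousSMul ℝ V'] (L : V →L[ℝ] V') (Z : Fin k → V) :
    frameMap (fun i => L (Z i)) = L.comp (frameMap Z) := by
  ext a
  simp only [ContinuousLinearMap.comp_apply, frameMap_apply, map_sum, map_smul]

end LinearAlgebra

section Calculus

variable {H V A B : Type*} [NormedAddCommGroup H] [NormedSpace ℝ H] [NormedAddCommGroup V]
  [NormedSpace ℝ V] [NormedAddCommGroup A] [NormedSpace ℝ A] [NormedAddCommGroup B]
  [NormedSpace ℝ B]

lemma contDiffAt_frameMap {k : ℕ} {n : WithTop ℕ∞} {Z : Fin k → H → V} {z₀ : H}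
    (hZ : ∀ i, ContDiffAt ℝ n (Z i) z₀) : ContDiffAt ℝ n (fun z => frameMap fun i => Z i z) z₀ :=
  ContDiffAt.sum fun i _ =>
    (ContinuousLinearMap.smulRightL ℝ (RSpace k) V (EuclideanSpace.proj i)).contDiff.contDiffAt.comp
      z₀ (hZ i)

/-- The solution is `F z = T z ((P z ∘ T z)⁻¹ v)`. -/
lemma exists_contDiffAt_lift [CompleteSpace A] {n : WithTop ℕ∞} {T : H → A →L[ℝ] V}
    {P : H → V →L[ℝ] B} {z₀ : H} (hT : ContDiffAt ℝ n T z₀) (hP : ContDiffAt ℝ n P z₀)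
    (hPT : ((P z₀).comp (T z₀)).IsInvertible) (v : B) :
    ∃ F : H → V, ContDiffAt ℝ n F z₀ ∧ ∀ᶠ z in 𝓝 z₀, ∀ a, P z (T z a) = v → T z a = F z := by
  have hG : ContDiffAt ℝ n (fun z => (P z).comp (T z)) z₀ := hP.clm_comp hT
  refine ⟨fun z => T z (((P z).comp (T z)).inverse v), hT.clm_apply
    ((hPT.contDiffAt_map_inverse.comp z₀ hG).clm_apply contDiffAt_const), ?_⟩
  have hinv : ∀ᶠ z in 𝓝 z₀, ((P z).comp (T z)).IsInvertible := by
    obtain ⟨e, he⟩ := hPT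
    exact hG.continuousAt.eventually_mem (he ▸ e.nhds)
  filter_upwards [hinv] with z hz a ha
  rw [hz.inverse_apply_eq.2 ha.symm]

variable {F : H → H} {f g : ℝ → H} {t₀ : ℝ}

lemma eventually_hasDerivWithinAt_Ici (hF : ContinuousAt F (f t₀))
    (hf : ContinuousWithinAt f (Ioi t₀) t₀)
    (hf' : ∀ᶠ t in 𝓝[>] t₀, HasDerivAt f (F (f t)) t) :
    ∀ᶠ t in 𝓝[≥] t₀, HasDerivWithinAt f (F (f t)) (Ici t₀) t := by
  have hlim : Filter.Tendsto (deriv f) (𝓝[>] t₀) (𝓝 (F (f t₀))) :=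
    (hF.tendsto.comp hf).congr' (hf'.mono fun t ht => ht.deriv.symm)
  obtain ⟨c, hc, hcf⟩ := mem_nhdsGT_iff_exists_Ioo_subset.1 hf'
  have hstart : HasDerivWithinAt f (F (f t₀)) (Ici t₀) t₀ :=
    hasDerivWithinAt_Ici_of_tendsto_deriv
      (fun t ht => (hcf ht).differentiableAt.differentiableWithinAt)
      (hf.mono Ioo_subset_Ioi_self) (Ioo_mem_nhdsGT hc) hlim
  rw [← nhdsGT_sup_nhdsWithin_singleton, nhdsWithin_singleton, Filter.eventually_sup]
  exact ⟨hf'.mono fun t ht => ht.hasDerivWithinAt, hstart⟩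

lemma eventuallyEq_nhdsGE_of_hasDerivWithinAt (hF : ContDiffAt ℝ 1 F (f t₀)) (h₀ : f t₀ = g t₀)
    (hf : ∀ᶠ t in 𝓝[≥] t₀, HasDerivWithinAt f (F (f t)) (Ici t₀) t)
    (hg : ∀ᶠ t in 𝓝[≥] t₀, HasDerivWithinAt g (F (g t)) (Ici t₀) t) :
    f =ᶠ[𝓝[≥] t₀] g := by
  obtain ⟨K, s, hs, hK⟩ := hF.exists_lipschitzOnWith
  have hfs : ∀ᶠ t in 𝓝[≥] t₀, f t ∈ s :=
    (hf.self_of_nhdsWithin self_mem_Ici).continuousWithinAt.eventually_mem hs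
  have hgs : ∀ᶠ t in 𝓝[≥] t₀, g t ∈ s :=
    (hg.self_of_nhdsWithin self_mem_Ici).continuousWithinAt.eventually_mem (h₀ ▸ hs)
  obtain ⟨b, hb, hfg⟩ := mem_nhdsGE_iff_exists_Icc_subset.1
    ((hf.and hfs).and (hg.and hgs))
  have hright : ∀ {φ : ℝ → H}, (∀ t ∈ Icc t₀ b, HasDerivWithinAt φ (F (φ t)) (Ici t₀) t) →
      ContinuousOn φ (Icc t₀ b) ∧ ∀ t ∈ Ico t₀ b, HasDerivWithinAt φ (F (φ t)) (Ici t) t :=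
    fun h => ⟨fun t ht => (h t ht).continuousWithinAt.mono Icc_subset_Ici_self,
      fun t ht => (h t (Ico_subset_Icc_self ht)).mono (Ici_subset_Ici.2 ht.1)⟩
  have hf' := hright fun t ht => (hfg ht).1.1
  have hg' := hright fun t ht => (hfg ht).2.1
  have heq : EqOn f g (Icc t₀ b) :=
    ODE_solution_unique_of_mem_Icc_right (v := fun _ => F) (s := fun _ => s) (fun _ _ => hK)
      hf'.1 hf'.2 (fun t ht => (hfg (Ico_subset_Icc_self ht)).1.2)
      hg'.1 hg'.2 (fun t ht => (hfg (Ico_subset_Icc_self ht)).2.2) h₀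
  exact Filter.eventually_of_mem (Icc_mem_nhdsGE hb) heq

end Calculus

section Charts

variable {H : Type*} [NormedAddCommGroup H] [NormedSpace ℝ H]
  {N : Type*} [TopologicalSpace N] [ChartedSpace H N]
  {W : Type*} [NormedAddCommGroup W] [NormedSpace ℝ W]
  {G : Type*} [NormedAddCommGroup G] [NormedSpace ℝ G]
  {e : OpenPartialHomeomorph N W} {p : N} {R : N → G}

lemma isSmoothChart_chartAt [IsManifold 𝓘(ℝ, H) ∞ N] (p : N) : IsSmoothChart H (chartAt H p) :=
  ⟨contMDiffOn_chart, contMDiffOn_chart_symm⟩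

lemma IsSmoothChart.contDiffAt_comp_symm {n : ℕ∞} (he : IsSmoothChart H e) (hp : p ∈ e.source)
    (hR : ContMDiffAt 𝓘(ℝ, H) 𝓘(ℝ, G) n R p) : ContDiffAt ℝ n (R ∘ e.symm) (e p) := by
  have hsymm : ContMDiffAt 𝓘(ℝ, W) 𝓘(ℝ, H) n e.symm (e p) :=
    (he.smooth_symm.of_le (WithTop.coe_le_coe.2 le_top)).contMDiffAt
      (e.open_target.mem_nhds (e.map_source hp))
  exact ContMDiffAt.contDiffAt (ContMDiffAt.comp (e p) ((e.left_inv hp).symm ▸ hR) hsymm)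

lemma IsSmoothChart.fderiv_comp_symm_chartD (he : IsSmoothChart H e) (hp : p ∈ e.source)
    (hR : MDifferentiableAt 𝓘(ℝ, H) 𝓘(ℝ, G) R p) (w : TangentSpace 𝓘(ℝ, H) p) :
    fderiv ℝ (R ∘ e.symm) (e p) (chartD H e p w) = mfderiv 𝓘(ℝ, H) 𝓘(ℝ, G) R p w := by
  have hRe : MDifferentiableAt 𝓘(ℝ, W) 𝓘(ℝ, G) (R ∘ e.symm) (e p) :=
    MDifferentiableAt.comp (e p) ((e.left_inv hp).symm ▸ hR)
      (he.mdiff.symm.mdifferentiableAt (e.map_source hp))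
  have hcomp := mfderiv_comp_apply p hRe (he.mdiff.mdifferentiableAt hp) w
  have heq : (R ∘ e.symm) ∘ e =ᶠ[𝓝 p] R :=
    Filter.eventually_of_mem (e.open_source.mem_nhds hp) fun y hy => congrArg R (e.left_inv hy)
  rw [heq.mfderiv_eq, mfderiv_eq_fderiv] at hcomp
  exact hcomp.symm

lemma IsSmoothVectorFieldOn.contDiffOn_chart [IsManifold 𝓘(ℝ, H) ∞ N] (he : IsSmoothChart H e)
    {X : ∀ p : N, TangentSpace 𝓘(ℝ, H) p} {V : Set N} (hX : IsSmoothVectorFieldOn X V) :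
    ContDiffOn ℝ ∞ (fun z => chartD H e (e.symm z) (X (e.symm z)))
      (e.target ∩ e.symm ⁻¹' V) := by
  have hTe : ContMDiffOn 𝓘(ℝ, H).tangent 𝓘(ℝ, W).tangent ∞
      (tangentMapWithin 𝓘(ℝ, H) 𝓘(ℝ, W) e e.source) _ :=
    he.smooth.contMDiffOn_tangentMapWithin (m := ∞) (by simp) e.open_source.uniqueMDiffOn
  have hXe : ContMDiffOn 𝓘(ℝ, W) 𝓘(ℝ, H).tangent ∞
      (fun z => (⟨e.symm z, X (e.symm z)⟩ : TangentBundle 𝓘(ℝ, H) N))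
      (e.target ∩ e.symm ⁻¹' V) :=
    hX.comp (he.smooth_symm.mono inter_subset_left) inter_subset_right
  have hcoord := (contMDiff_snd_tangentBundle_modelSpace W 𝓘(ℝ, W)).comp_contMDiffOn
    (hTe.comp hXe fun z hz => e.map_target hz.1)
  refine contMDiffOn_iff_contDiffOn.1 (hcoord.congr fun z hz => ?_)
  exact congrArg (fun L : TangentSpace 𝓘(ℝ, H) (e.symm z) →L[ℝ] W => L (X (e.symm z)))
    (mfderivWithin_of_isOpen e.open_source (e.map_target hz.1)).symm

end Charts

section Curves

variable {H : Type*} [NormedAddCommGroup H] [NormedSpace ℝ H]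
  {N : Type*} [TopologicalSpace N] [ChartedSpace H N]
  {G : Type*} [NormedAddCommGroup G] [NormedSpace ℝ G]

/-- The curve `f` in `N` has velocity `w` at time `t`. -/
def HasVelocityAt (f : ℝ → N) (t : ℝ) (w : TangentSpace 𝓘(ℝ, H) (f t)) : Prop :=
  HasMFDerivAt 𝓘(ℝ, ℝ) 𝓘(ℝ, H) f t ((1 : ℝ →L[ℝ] ℝ).smulRight w)

lemma HasVelocityAt.hasDerivAt_comp {g : N → G} {f : ℝ → N} {t : ℝ}
    {w : TangentSpace 𝓘(ℝ, H) (f t)} {v : G} (hf : HasVelocityAt f t w)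
    (hg : MDifferentiableAt 𝓘(ℝ, H) 𝓘(ℝ, G) g (f t))
    (hv : mfderiv 𝓘(ℝ, H) 𝓘(ℝ, G) g (f t) w = v) : HasDerivAt (g ∘ f) v t := by
  have hcomp : (mfderiv 𝓘(ℝ, H) 𝓘(ℝ, G) g (f t)).comp ((1 : ℝ →L[ℝ] ℝ).smulRight w) =
      ContinuousLinearMap.toSpanSingleton ℝ v :=
    ContinuousLinearMap.ext fun a => (map_smul _ a w).trans (congrArg (a • ·) hv)
  exact hasDerivAt_iff_hasFDerivAt.2 (hasMFDerivAt_iff_hasFDerivAt.1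
    ((hg.hasMFDerivAt.comp t hf).congr_mfderiv hcomp))

/-- The curve `f` in `N` is differentiable at time `t`, with velocity in the distribution `D`. -/
def IsTangentCurveAt (D : ∀ p : N, Submodule ℝ (TangentSpace 𝓘(ℝ, H) p)) (f : ℝ → N) (t : ℝ) :
    Prop :=
  ∃ w ∈ D (f t), HasVelocityAt f t w

end Curves

section Lifts

variable {H : Type*} [NormedAddCommGroup H] [NormedSpace ℝ H]
  {N : Type*} [TopologicalSpace N] [ChartedSpace H N] [IsManifold 𝓘(ℝ, H) ∞ N]
  {W : Type*} [NormedAddCommGroup W] [NormedSpace ℝ W]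
  {k : ℕ} {D : ∀ p : N, Submodule ℝ (TangentSpace 𝓘(ℝ, H) p)} {R : N → RSpace k} {q : N}

lemma IsSmoothDistribution.exists_frame_chart (hD : IsSmoothDistribution k D)
    {e : OpenPartialHomeomorph N W} (he : IsSmoothChart H e) (hq : q ∈ e.source) :
    ∃ Z : Fin k → ∀ p : N, TangentSpace 𝓘(ℝ, H) p, LinearIndependent ℝ (fun i => Z i q) ∧
      (∀ᶠ p in 𝓝 q, Submodule.span ℝ (range fun i => Z i p) = D p) ∧
      ∀ i, ContDiffAt ℝ ∞ (fun z => chartD H e (e.symm z) (Z i (e.symm z))) (e q) := by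
  obtain ⟨V, hVo, hqV, Z, hZ, hspan⟩ := hD q
  have hV : e.target ∩ e.symm ⁻¹' V ∈ 𝓝 (e q) :=
    (e.symm.isOpen_inter_preimage hVo).mem_nhds
      ⟨e.map_source hq, mem_preimage.2 ((e.left_inv hq).symm ▸ hqV)⟩
  exact ⟨Z, (hspan q hqV).1, Filter.eventually_of_mem (hVo.mem_nhds hqV) fun p hp => (hspan p hp).2,
    fun i => ((hZ i).contDiffOn_chart he).contDiffAt hV⟩

lemma IsSmoothDistribution.exists_lift (hD : IsSmoothDistribution k D)
    (hR : ContMDiffAt 𝓘(ℝ, H) 𝓘(ℝ, RSpace k) 2 R q)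
    (hinj : ∀ w ∈ D q, mfderiv 𝓘(ℝ, H) 𝓘(ℝ, RSpace k) R q w = 0 → w = 0)
    {e : OpenPartialHomeomorph N W} (he : IsSmoothChart H e) (hq : q ∈ e.source) (v : RSpace k) :
    ∃ F : W → W, ContDiffAt ℝ 1 F (e q) ∧ ∀ᶠ p in 𝓝 q, ∀ w ∈ D p,
      mfderiv 𝓘(ℝ, H) 𝓘(ℝ, RSpace k) R p w = v → chartD H e p w = F (e p) := by
  obtain ⟨Z, hZq, hspan, hZ⟩ := hD.exists_frame_chart he hq
  let T : W → RSpace k →L[ℝ] W := fun z =>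
    frameMap fun i => chartD H e (e.symm z) (Z i (e.symm z))
  have hTe : ∀ p ∈ e.source, T (e p) = (chartD H e p).comp (frameMap fun i => Z i p) := by
    intro p hp
    simp only [T, frameMap_comp]
    rw [e.left_inv hp]
  have hRe : ∀ᶠ p in 𝓝 q, ∀ w, fderiv ℝ (R ∘ e.symm) (e p) (chartD H e p w) =
      mfderiv 𝓘(ℝ, H) 𝓘(ℝ, RSpace k) R p w := by
    filter_upwards [(contMDiffAt_iff_contMDiffAt_nhds (by simp)).1 hR,
      e.open_source.mem_nhds hq] with p hRp hp
    exact he.fderiv_comp_symm_chartD hp (hRp.mdifferentiableAt (by simp))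
  have hinv : ((fderiv ℝ (R ∘ e.symm) (e q)).comp (T (e q))).IsInvertible := by
    refine isInvertible_of_injective ((injective_iff_map_eq_zero _).2 fun a ha => ?_)
    rw [hTe q hq, ContinuousLinearMap.comp_apply, ContinuousLinearMap.comp_apply,
      hRe.self_of_nhds] at ha
    have hmem : frameMap (fun i => Z i q) a ∈ D q := by
      rw [← hspan.self_of_nhds]
      exact mem_span_range_iff_exists_frameMap.2 ⟨a, rfl⟩
    exact (injective_iff_map_eq_zero _).1 (frameMap_injective hZq) a (hinj _ hmem ha)
  obtain ⟨F, hF, hlift⟩ := exists_contDiffAt_lift (n := 1)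
    (contDiffAt_frameMap fun i => (hZ i).of_le (by simp))
    ((he.contDiffAt_comp_symm hq (n := 2) hR).fderiv_right (by norm_num)) hinv v
  refine ⟨F, hF, ?_⟩
  filter_upwards [(e.continuousAt hq).eventually hlift, hspan, hRe, e.open_source.mem_nhds hq]
    with p hp hDp hRp hpe w hw hv
  rw [← hDp] at hw
  obtain ⟨a, rfl⟩ := mem_span_range_iff_exists_frameMap.1 hw
  have hTa : T (e p) a = chartD H e p (frameMap (fun i => Z i p) a) := by rw [hTe p hpe]; rfl
  rw [← hTa]
  exact hp a (by rw [hTa, hRp, hv])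

lemma IsSmoothDistribution.eventuallyEq_of_isTangentCurveAt (hD : IsSmoothDistribution k D)
    {f g : ℝ → N} {t₀ : ℝ} {v : RSpace k} (h₀ : f t₀ = g t₀)
    (hR : ContMDiffAt 𝓘(ℝ, H) 𝓘(ℝ, RSpace k) 2 R (f t₀))
    (hinj : ∀ w ∈ D (f t₀), mfderiv 𝓘(ℝ, H) 𝓘(ℝ, RSpace k) R (f t₀) w = 0 → w = 0)
    (hfc : ContinuousWithinAt f (Ioi t₀) t₀) (hgc : ContinuousWithinAt g (Ioi t₀) t₀)
    (hf : ∀ᶠ t in 𝓝[>] t₀, IsTangentCurveAt D f t ∧ HasDerivAt (R ∘ f) v t)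
    (hg : ∀ᶠ t in 𝓝[>] t₀, IsTangentCurveAt D g t ∧ HasDerivAt (R ∘ g) v t) :
    f =ᶠ[𝓝[>] t₀] g := by
  set e := chartAt H (f t₀)
  have he : IsSmoothChart H e := isSmoothChart_chartAt (f t₀)
  have hsource : f t₀ ∈ e.source := mem_chart_source H (f t₀)
  obtain ⟨F, hF, hlift⟩ := hD.exists_lift hR hinj he hsource v
  have hcoord : ∀ {φ : ℝ → N}, φ t₀ = f t₀ → ContinuousWithinAt φ (Ioi t₀) t₀ →
      (∀ᶠ t in 𝓝[>] t₀, IsTangentCurveAt D φ t ∧ HasDerivAt (R ∘ φ) v t) →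
      (∀ᶠ t in 𝓝[>] t₀, φ t ∈ e.source) ∧
      ∀ᶠ t in 𝓝[≥] t₀, HasDerivWithinAt (e ∘ φ) (F ((e ∘ φ) t)) (Ici t₀) t := by
    intro φ hφ₀ hφc hφ
    rw [← hφ₀] at hR hF hlift hsource
    have hφe : ∀ᶠ t in 𝓝[>] t₀, φ t ∈ e.source :=
      hφc.eventually_mem (e.open_source.mem_nhds hsource)
    refine ⟨hφe, eventually_hasDerivWithinAt_Ici hF.continuousAt
      ((e.continuousAt hsource).comp_continuousWithinAt hφc) ?_⟩
    filter_upwards [hφ, hφe, hφc.eventually hlift,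
      hφc.eventually ((contMDiffAt_iff_contMDiffAt_nhds (by simp)).1 hR)]
      with t ⟨⟨w, hw, hder⟩, hRφ⟩ hte hFt hRt
    have hwv : mfderiv 𝓘(ℝ, H) 𝓘(ℝ, RSpace k) R (φ t) w = v :=
      (hder.hasDerivAt_comp (hRt.mdifferentiableAt (by simp)) rfl).unique hRφ
    exact hder.hasDerivAt_comp (he.mdiff.mdifferentiableAt hte) (hFt w hw hwv)
  obtain ⟨hfe, hf'⟩ := hcoord rfl hfc hf
  obtain ⟨hge, hg'⟩ := hcoord h₀.symm hgc hg
  have heq := eventuallyEq_nhdsGE_of_hasDerivWithinAt hF (congrArg e h₀) hf' hg'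
  filter_upwards [heq.filter_mono (nhdsWithin_mono t₀ Ioi_subset_Ici_self), hfe, hge]
    with t ht hft hgt using e.injOn hft hgt ht

end Lifts

section CoordinateLines

variable {m : ℕ} {M : Type*} [TopologicalSpace M] [ChartedSpace (RSpace m) M]
  {b : OpenPartialHomeomorph M (RSpace m)} {c : ℝ → M} {v : RSpace m} {t : ℝ}

/-- Near time `t` the curve `c` in `M` is differentiable and runs in the domain of the chart `b`,
where it reads as a straight line with constant velocity `v`. -/
def IsCoordinateLineAt (b : OpenPartialHomeomorph M (RSpace m)) (v : RSpace m) (c : ℝ → M)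
    (t : ℝ) : Prop :=
  ∀ᶠ s in 𝓝 t, MDifferentiableAt 𝓘(ℝ, ℝ) 𝓘(ℝ, RSpace m) c s ∧ c s ∈ b.source ∧
    HasDerivAt (b ∘ c) v s

lemma IsCoordinateLineAt.continuousAt (hc : IsCoordinateLineAt b v c t) : ContinuousAt c t :=
  hc.self_of_nhds.1.continuousAt

lemma IsCoordinateLineAt.mem_source (hc : IsCoordinateLineAt b v c t) : c t ∈ b.source :=
  hc.self_of_nhds.2.1

lemma IsSmoothChart.isCoordinateLineAt_lineMap (hb : IsSmoothChart (RSpace m) b) {z w : RSpace m}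
    (ht : AffineMap.lineMap z w t ∈ b.target) :
    IsCoordinateLineAt b (w - z) (fun s => b.symm (AffineMap.lineMap z w s)) t := by
  have hline : ∀ s, HasDerivAt (AffineMap.lineMap z w : ℝ → RSpace m) (w - z) s :=
    fun s => AffineMap.hasDerivAt_lineMap
  have htarget : ∀ᶠ s in 𝓝 t, (AffineMap.lineMap z w s : RSpace m) ∈ b.target :=
    (hline t).continuousAt.eventually_mem (b.open_target.mem_nhds ht)
  filter_upwards [htarget.eventually_nhds] with s hs
  refine ⟨(hb.mdiff.symm.mdifferentiableAt hs.self_of_nhds).comp s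
    (hline s).differentiableAt.mdifferentiableAt, b.map_target hs.self_of_nhds,
    (hline s).congr_of_eventuallyEq ?_⟩
  filter_upwards [hs] with r hr using b.right_inv hr

lemma IsSmoothChart.eventually_exists_coordinateLine (hb : IsSmoothChart (RSpace m) b) {x₀ : M}
    (hx₀ : x₀ ∈ b.source) {O : Set M} (hO : O ∈ 𝓝 x₀) :
    ∀ᶠ x in 𝓝 x₀, ∃ (v : RSpace m) (c : ℝ → M), c 0 = x₀ ∧ c 1 = x ∧
      ∀ t ∈ Icc (0 : ℝ) 1, c t ∈ O ∧ IsCoordinateLineAt b v c t := by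
  have hOb : b.target ∩ b.symm ⁻¹' O ∈ 𝓝 (b x₀) :=
    Filter.inter_mem (b.open_target.mem_nhds (b.map_source hx₀))
      ((b.symm.continuousAt (b.map_source hx₀)).preimage_mem_nhds ((b.left_inv hx₀).symm ▸ hO))
  obtain ⟨r, hr, hball⟩ := Metric.mem_nhds_iff.1 hOb
  filter_upwards [b.open_source.mem_nhds hx₀,
    (b.continuousAt hx₀).eventually_mem (Metric.ball_mem_nhds _ hr)] with x hx hxr
  have hline : ∀ t ∈ Icc (0 : ℝ) 1,
      AffineMap.lineMap (b x₀) (b x) t ∈ b.target ∩ b.symm ⁻¹' O :=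
    fun t ht => hball ((convex_ball _ _).lineMap_mem (Metric.mem_ball_self hr) hxr ht)
  exact ⟨b x - b x₀, fun t => b.symm (AffineMap.lineMap (b x₀) (b x) t),
    by simp [b.left_inv hx₀], by simp [b.left_inv hx],
    fun t ht => ⟨(hline t ht).2, hb.isCoordinateLineAt_lineMap (hline t ht).1⟩⟩

end CoordinateLines

section IntegralSections

variable {m : ℕ} {M : Type*} [TopologicalSpace M] [ChartedSpace (RSpace m) M]
  {H : Type*} [NormedAddCommGroup H] [NormedSpace ℝ H]
  {N : Type*} [TopologicalSpace N] [ChartedSpace H N]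
  {ρ : N → M} {D : ∀ p : N, Submodule ℝ (TangentSpace 𝓘(ℝ, H) p)}
  {b : OpenPartialHomeomorph M (RSpace m)} {c : ℝ → M} {v : RSpace m} {t₀ : ℝ}
  {S : Set N} {U : Set M} {ψ : M → N}

lemma IsLocalSection.mdifferentiableAt (hψ : IsLocalSection (m := m) (H := H) ρ U ψ) {x : M}
    (hx : x ∈ U) : MDifferentiableAt 𝓘(ℝ, RSpace m) 𝓘(ℝ, H) ψ x :=
  (hψ.smooth.contMDiffAt (hψ.isOpen.mem_nhds hx)).mdifferentiableAt (by simp)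

lemma IsLocalSection.mfderiv_comp_eq_id (hψ : IsLocalSection (m := m) (H := H) ρ U ψ) {x : M}
    (hx : x ∈ U) : mfderiv 𝓘(ℝ, RSpace m) 𝓘(ℝ, RSpace m) (fun y => ρ (ψ y)) x =
      ContinuousLinearMap.id ℝ (RSpace m) := by
  refine Eq.trans (Filter.EventuallyEq.mfderiv_eq ?_) (mfderiv_id (x := x))
  filter_upwards [hψ.isOpen.mem_nhds hx] with y hy using hψ.right_inv y hy

lemma IsIntegralSection.isTangentCurveAt (hψ : IsIntegralSection (m := m) ρ D U ψ) {t : ℝ}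
    (hc : MDifferentiableAt 𝓘(ℝ, ℝ) 𝓘(ℝ, RSpace m) c t) (ht : c t ∈ U) :
    IsTangentCurveAt D (ψ ∘ c) t := by
  let w := mfderiv 𝓘(ℝ, ℝ) 𝓘(ℝ, RSpace m) c t (1 : ℝ)
  refine ⟨mfderiv 𝓘(ℝ, RSpace m) 𝓘(ℝ, H) ψ (c t) w, ?_, ?_⟩
  · exact hψ.tangent (c t) ht ▸ LinearMap.mem_range_self _ w
  · refine ((hψ.mdifferentiableAt ht).hasMFDerivAt.comp t hc.hasMFDerivAt).congr_mfderiv ?_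
    exact ContinuousLinearMap.ext_ring (one_smul ℝ _).symm

lemma IsIntegralSection.hasDerivAt_comp_coordinateLine
    (hψ : IsIntegralSection (m := m) ρ D U ψ) {t : ℝ} (hc : ContinuousAt c t) (ht : c t ∈ U)
    (hbc : HasDerivAt (b ∘ c) v t) : HasDerivAt ((b ∘ ρ) ∘ ψ ∘ c) v t := by
  refine hbc.congr_of_eventuallyEq ?_
  filter_upwards [hc.eventually_mem (hψ.isOpen.mem_nhds ht)] with s hs
  exact congrArg b (hψ.right_inv _ hs)

lemma IsTransverse.eq_zero_of_mfderiv_chart_comp [IsManifold 𝓘(ℝ, RSpace m) ∞ M]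
    (hT : IsTransverse (m := m) ρ D) {q : N}
    (hρ : MDifferentiableAt 𝓘(ℝ, H) 𝓘(ℝ, RSpace m) ρ q) (hb : IsSmoothChart (RSpace m) b)
    (hq : ρ q ∈ b.source) {w : TangentSpace 𝓘(ℝ, H) q} (hw : w ∈ D q)
    (hw₀ : mfderiv 𝓘(ℝ, H) 𝓘(ℝ, RSpace m) (b ∘ ρ) q w = 0) : w = 0 := by
  obtain ⟨L, hL⟩ := hb.exists_equiv hq
  refine hT q w hw (L.map_eq_zero_iff.1 ?_)
  rw [mfderiv_comp_apply q (hb.mdiff.mdifferentiableAt hq) hρ] at hw₀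
  exact (DFunLike.congr_fun hL _).symm.trans hw₀

lemma IsIntegralSection.eventuallyEq_comp_coordinateLine [IsManifold 𝓘(ℝ, RSpace m) ∞ M]
    [IsManifold 𝓘(ℝ, H) ∞ N] {W : Set M} {χ : M → N}
    (hψ : IsIntegralSection (m := m) ρ D U ψ) (hχ : IsIntegralSection (m := m) ρ D W χ)
    (hρ : ContMDiff 𝓘(ℝ, H) 𝓘(ℝ, RSpace m) ∞ ρ) (hD : IsSmoothDistribution m D)
    (hT : IsTransverse (m := m) ρ D) (hb : IsSmoothChart (RSpace m) b)
    (hc : IsCoordinateLineAt b v c t₀) (hcU : ∀ᶠ t in 𝓝[>] t₀, c t ∈ U) (hcW : c t₀ ∈ W)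
    (hψc : ContinuousWithinAt (ψ ∘ c) (Ioi t₀) t₀) (h₀ : χ (c t₀) = ψ (c t₀)) :
    ψ ∘ c =ᶠ[𝓝[>] t₀] χ ∘ c := by
  have hχρ : ρ (χ (c t₀)) = c t₀ := hχ.right_inv _ hcW
  have hsource : ρ (χ (c t₀)) ∈ b.source := by rw [hχρ]; exact hc.mem_source
  have hbρ : ContMDiffAt 𝓘(ℝ, H) 𝓘(ℝ, RSpace m) ∞ (b ∘ ρ) (χ (c t₀)) :=
    (hb.smooth.contMDiffAt (b.open_source.mem_nhds hsource)).comp _ hρ.contMDiffAt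
  have hcWt : ∀ᶠ t in 𝓝[>] t₀, c t ∈ W :=
    nhdsWithin_le_nhds (hc.continuousAt.eventually_mem (hχ.isOpen.mem_nhds hcW))
  have htangent : ∀ {V : Set M} {φ : M → N}, IsIntegralSection (m := m) ρ D V φ →
      (∀ᶠ t in 𝓝[>] t₀, c t ∈ V) →
      ∀ᶠ t in 𝓝[>] t₀, IsTangentCurveAt D (φ ∘ c) t ∧ HasDerivAt ((b ∘ ρ) ∘ φ ∘ c) v t := by
    intro V φ hφ hV
    filter_upwards [hV, nhdsWithin_le_nhds hc] with t ht ⟨hct, _, hbct⟩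
    exact ⟨hφ.isTangentCurveAt hct ht,
      hφ.hasDerivAt_comp_coordinateLine hct.continuousAt ht hbct⟩
  refine (hD.eventuallyEq_of_isTangentCurveAt (f := χ ∘ c) (g := ψ ∘ c) h₀
    (hbρ.of_le ENat.LEInfty.out)
    (fun w => hT.eq_zero_of_mfderiv_chart_comp (hρ.mdifferentiableAt (by simp)) hb hsource)
    ?_ hψc (htangent hχ hcWt) (htangent hψ hcU)).symm
  exact ((hχ.mdifferentiableAt hcW).continuousAt.comp hc.continuousAt).continuousWithinAt

end IntegralSections

section Foliated

variable {m : ℕ} {M : Type*} [TopologicalSpace M] [ChartedSpace (RSpace m) M]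
  [IsManifold 𝓘(ℝ, RSpace m) ∞ M]
  {H : Type*} [NormedAddCommGroup H] [NormedSpace ℝ H]
  {N : Type*} [TopologicalSpace N] [ChartedSpace H N] [IsManifold 𝓘(ℝ, H) ∞ N]
  {ρ : N → M} {D : ∀ p : N, Submodule ℝ (TangentSpace 𝓘(ℝ, H) p)}
  {b : OpenPartialHomeomorph M (RSpace m)} {c : ℝ → M} {v : RSpace m}
  {S : Set N} {U : Set M} {ψ : M → N}

variable (m) in
/-- The set `S` contains an integral section of `D` through each of its points. -/
def IsFoliated (ρ : N → M) (D : ∀ p : N, Submodule ℝ (TangentSpace 𝓘(ℝ, H) p)) (S : Set N) :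
    Prop :=
  ∀ q ∈ S, ∃ (W : Set M) (χ : M → N),
    ρ q ∈ W ∧ χ (ρ q) = q ∧ IsIntegralSection (m := m) ρ D W χ ∧ MapsTo χ W S

lemma IsFoliated.eventually_mem_comp_coordinateLine (hS : IsFoliated m ρ D S)
    (hρ : ContMDiff 𝓘(ℝ, H) 𝓘(ℝ, RSpace m) ∞ ρ) (hD : IsSmoothDistribution m D)
    (hT : IsTransverse (m := m) ρ D) (hψ : IsIntegralSection (m := m) ρ D U ψ)
    (hb : IsSmoothChart (RSpace m) b) {t₀ : ℝ} (hc : IsCoordinateLineAt b v c t₀)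
    (hcU : ∀ᶠ t in 𝓝[>] t₀, c t ∈ U) (hψc : ContinuousWithinAt (ψ ∘ c) (Ioi t₀) t₀)
    (hmem : ψ (c t₀) ∈ S) (hsection : ρ (ψ (c t₀)) = c t₀) :
    ∀ᶠ t in 𝓝[>] t₀, ψ (c t) ∈ S := by
  obtain ⟨W, χ, hW, hχ₀, hχ, hχS⟩ := hS _ hmem
  rw [hsection] at hW hχ₀
  filter_upwards [hψ.eventuallyEq_comp_coordinateLine hχ hρ hD hT hb hc hcU hW hψc hχ₀,
    nhdsWithin_le_nhds (hc.continuousAt.eventually_mem (hχ.isOpen.mem_nhds hW))] with t heq ht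
  exact (show ψ (c t) = χ (c t) from heq) ▸ hχS ht

lemma IsFoliated.mem_of_coordinateLine (hS : IsFoliated m ρ D S) (hSc : IsClosed S)
    (hρ : ContMDiff 𝓘(ℝ, H) 𝓘(ℝ, RSpace m) ∞ ρ) (hD : IsSmoothDistribution m D)
    (hT : IsTransverse (m := m) ρ D) (hψ : IsIntegralSection (m := m) ρ D U ψ)
    (hb : IsSmoothChart (RSpace m) b)
    (hc : ∀ t ∈ Icc (0 : ℝ) 1, c t ∈ U ∧ IsCoordinateLineAt b v c t) (h₀ : ψ (c 0) ∈ S) :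
    ψ (c 1) ∈ S := by
  have hψc : ∀ t ∈ Icc (0 : ℝ) 1, ContinuousAt (ψ ∘ c) t := fun t ht =>
    (hψ.mdifferentiableAt (hc t ht).1).continuousAt.comp (hc t ht).2.continuousAt
  have hclosed : IsClosed ((ψ ∘ c) ⁻¹' S ∩ Icc (0 : ℝ) 1) := by
    rw [inter_comm]
    exact ContinuousOn.preimage_isClosed_of_isClosed
      (fun t ht => (hψc t ht).continuousWithinAt) isClosed_Icc hSc
  refine hclosed.Icc_subset_of_forall_exists_gt h₀ (fun t ⟨htS, ht⟩ y hy => ?_)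
    (right_mem_Icc.2 zero_le_one)
  obtain ⟨htU, hct⟩ := hc t (Ico_subset_Icc_self ht)
  have hev := hS.eventually_mem_comp_coordinateLine hρ hD hT hψ hb hct
    (nhdsWithin_le_nhds (hct.continuousAt.eventually_mem (hψ.isOpen.mem_nhds htU)))
    (hψc t (Ico_subset_Icc_self ht)).continuousWithinAt htS (hψ.right_inv _ htU)
  exact (hev.and (Ioc_mem_nhdsGT hy)).exists

lemma IsFoliated.eventually_mem (hS : IsFoliated m ρ D S) (hSc : IsClosed S)
    (hρ : ContMDiff 𝓘(ℝ, H) 𝓘(ℝ, RSpace m) ∞ ρ) (hD : IsSmoothDistribution m D)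
    (hT : IsTransverse (m := m) ρ D) (hψ : IsIntegralSection (m := m) ρ D U ψ) {x₀ : M}
    (hx₀ : x₀ ∈ U) (hmem : ψ x₀ ∈ S) : ∀ᶠ x in 𝓝 x₀, ψ x ∈ S := by
  have hb : IsSmoothChart (RSpace m) (chartAt (RSpace m) x₀) := isSmoothChart_chartAt x₀
  filter_upwards [hb.eventually_exists_coordinateLine (mem_chart_source _ x₀)
    (hψ.isOpen.mem_nhds hx₀)] with x ⟨v, c, hc₀, hc₁, hc⟩
  exact hc₁ ▸ hS.mem_of_coordinateLine hSc hρ hD hT hψ hb hc (hc₀.symm ▸ hmem)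

lemma IsFoliated.mapsTo (hS : IsFoliated m ρ D S) (hSc : IsClosed S)
    (hρ : ContMDiff 𝓘(ℝ, H) 𝓘(ℝ, RSpace m) ∞ ρ) (hD : IsSmoothDistribution m D)
    (hT : IsTransverse (m := m) ρ D) (hψ : IsIntegralSection (m := m) ρ D U ψ)
    (hU : IsPreconnected U) (hne : ∃ x ∈ U, ψ x ∈ S) : MapsTo ψ U S := by
  have hopen : IsOpen (U ∩ ψ ⁻¹' S) := isOpen_iff_eventually.2 fun x ⟨hx, hxS⟩ =>
    (hψ.isOpen.eventually_mem hx).and (hS.eventually_mem hSc hρ hD hT hψ hx hxS)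
  have hopen' : IsOpen (U ∩ ψ ⁻¹' Sᶜ) :=
    hψ.smooth.continuousOn.isOpen_inter_preimage hψ.isOpen hSc.isOpen_compl
  have hcover : U ⊆ U ∩ ψ ⁻¹' S ∪ U ∩ ψ ⁻¹' Sᶜ := by
    rw [← inter_union_distrib_left, preimage_compl, union_compl_self, inter_univ]
  have hdisj : Disjoint (U ∩ ψ ⁻¹' S) (U ∩ ψ ⁻¹' Sᶜ) :=
    disjoint_left.2 fun x h h' => h'.2 h.2
  obtain ⟨x, hx, hxS⟩ := hne
  exact fun y hy =>
    (hU.subset_left_of_subset_union hopen hopen' hdisj hcover ⟨x, hx, hx, hxS⟩ hy).2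

end Foliated

section BoundaryConditions

lemma exists_mem_frontier_forall_Ioc_mem {M : Type*} [TopologicalSpace M] {U : Set M}
    {c : ℝ → M} {a b : ℝ} (hab : a ≤ b) (hc : ContinuousOn c (Icc a b)) (hU : IsOpen U)
    (ha : c a ∉ U) (hb : c b ∈ U) :
    ∃ t ∈ Ico a b, c t ∈ frontier U ∧ ∀ s ∈ Ioc t b, c s ∈ U := by
  have hcompact : IsCompact (Icc a b ∩ c ⁻¹' Uᶜ) := isCompact_Icc.of_isClosed_subset
    (hc.preimage_isClosed_of_isClosed isClosed_Icc hU.isClosed_compl) inter_subset_left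
  obtain ⟨t, ⟨ht, htU⟩, hmax⟩ := hcompact.exists_isGreatest ⟨a, left_mem_Icc.2 hab, ha⟩
  have htb : t < b := ht.2.lt_of_ne fun h => htU (h ▸ hb)
  have hafter : ∀ s ∈ Ioc t b, c s ∈ U := fun s hs =>
    by_contra fun h => (hmax ⟨⟨ht.1.trans hs.1.le, hs.2⟩, h⟩).not_gt hs.1
  have hclosure : c t ∈ closure U := by
    have hct : ContinuousWithinAt c (Ioc t b) t :=
      (hc t ht).mono fun s hs => ⟨ht.1.trans hs.1.le, hs.2⟩
    refine hct.mem_closure ?_ hafter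
    rw [closure_Ioc htb.ne]
    exact left_mem_Icc.2 htb.le
  exact ⟨t, ⟨ht.1, htb⟩, hU.frontier_eq ▸ ⟨hclosure, htU⟩, hafter⟩

lemma IsFoliated.exists_mem_of_boundaryConditions {m : ℕ} {M : Type*} [TopologicalSpace M]
    [T2Space M] [ChartedSpace (RSpace m) M] [IsManifold 𝓘(ℝ, RSpace m) ∞ M]
    {H : Type*} [NormedAddCommGroup H] [NormedSpace ℝ H]
    {N : Type*} [TopologicalSpace N] [ChartedSpace H N] [IsManifold 𝓘(ℝ, H) ∞ N]
    {ρ : N → M} {D : ∀ p : N, Submodule ℝ (TangentSpace 𝓘(ℝ, H) p)} {S : Set N} {U : Set M}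
    {ψ : M → N} (hS : IsFoliated m ρ D S)
    (hρ : ContMDiff 𝓘(ℝ, H) 𝓘(ℝ, RSpace m) ∞ ρ) (hD : IsSmoothDistribution m D)
    (hT : IsTransverse (m := m) ρ D) (hψ : IsIntegralSection (m := m) ρ D U ψ)
    (hbc : HasBoundaryConditionsIn U ψ S) : ∃ x ∈ U, ψ x ∈ S := by
  rcases hbc with hinner | ⟨O, hO, ⟨x₀, hx₀O, hx₀U⟩, hcont, hmaps⟩
  · exact hinner
  have hb : IsSmoothChart (RSpace m) (chartAt (RSpace m) x₀) := isSmoothChart_chartAt x₀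
  obtain ⟨x, hxU, v, c, rfl, rfl, hc⟩ := ((mem_closure_iff_frequently.1
    (frontier_subset_closure hx₀U)).and_eventually
      (hb.eventually_exists_coordinateLine (mem_chart_source _ x₀) (hO.mem_nhds hx₀O))).exists
  have hx₀ : c 0 ∉ U := (hψ.isOpen.frontier_eq ▸ hx₀U).2
  obtain ⟨t, ht, hfrontier, hafter⟩ := exists_mem_frontier_forall_Ioc_mem zero_le_one
    (fun s hs => (hc s hs).2.continuousAt.continuousWithinAt) hψ.isOpen hx₀ hxU
  obtain ⟨htO, hct⟩ := hc t (Ico_subset_Icc_self ht)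
  have hcU : ∀ᶠ s in 𝓝[>] t, c s ∈ U := Filter.eventually_of_mem (Ioc_mem_nhdsGT ht.2) hafter
  have hψc : ContinuousWithinAt (ψ ∘ c) (Ioi t) t :=
    (hcont (c t) (Or.inr ⟨htO, hfrontier⟩)).tendsto.comp (tendsto_nhdsWithin_iff.2
      ⟨hct.continuousAt.continuousWithinAt, hcU.mono fun s hs => Or.inl hs⟩)
  have hsection : ρ (ψ (c t)) = c t := by
    refine tendsto_nhds_unique ((hρ.continuous.tendsto _).comp hψc)
      (Filter.Tendsto.congr' ?_ hct.continuousAt.continuousWithinAt)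
    filter_upwards [hcU] with s hs using (hψ.right_inv _ hs).symm
  obtain ⟨s, hsU, hsS⟩ := (hcU.and (hS.eventually_mem_comp_coordinateLine hρ hD hT hψ hb hct hcU
    hψc (hmaps ⟨htO, hfrontier⟩) hsection)).exists
  exact ⟨c s, hsU, hsS⟩

end BoundaryConditions

section SeparatedMaps

lemma isClosed_range_of_leftInverse {N E : Type*} [TopologicalSpace N] [TopologicalSpace E]
    {pr : N → E} {σ : E → N} (hsep : IsSeparatedMap pr) (hpr : Continuous pr) (hσ : Continuous σ)
    (hσpr : Function.LeftInverse pr σ) : IsClosed (range σ) := by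
  have hrange : range σ = {q | σ (pr q) = q} :=
    Subset.antisymm (range_subset_iff.2 fun u => congrArg σ (hσpr u)) fun q hq => ⟨pr q, hq⟩
  rw [hrange]
  exact hsep.isClosed_eqLocus (hσ.comp hpr) continuous_id (funext fun q => hσpr (pr q))

lemma isSeparatedMap_of_mem_chartAt_source {H N E : Type*} [TopologicalSpace H] [T2Space H]
    [TopologicalSpace N] [ChartedSpace H N] {pr : N → E}
    (h : ∀ q q', pr q = pr q' → q' ∈ (chartAt H q).source) : IsSeparatedMap pr := by
  refine isSeparatedMap_iff_disjoint_nhds.2 fun q q' hqq' hne => ?_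
  have hq := mem_chart_source H q
  have hq' := h q q' hqq'
  exact ((chartAt H q).continuousAt hq).disjoint
    (disjoint_nhds_nhds.2 fun heq => hne ((chartAt H q).injOn hq hq' heq))
    ((chartAt H q).continuousAt hq')

end SeparatedMaps

section ProjectedDistributions

variable {m : ℕ} {M : Type*} [TopologicalSpace M] [ChartedSpace (RSpace m) M]
  {B : Type*} [NormedAddCommGroup B] [NormedSpace ℝ B]
  {E : Type*} [TopologicalSpace E] [ChartedSpace B E]
  {H : Type*} [NormedAddCommGroup H] [NormedSpace ℝ H]
  {N : Type*} [TopologicalSpace N] [ChartedSpace H N]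
  {π : E → M} {pr : N → E} {σ : E → N}
  {D : ∀ p : N, Submodule ℝ (TangentSpace 𝓘(ℝ, H) p)} {U : Set M} {ψ : M → N}

/-- The distribution `T pr(D|_{Im σ})` on `E`, for a section `σ` of `pr : N → E`. The tangent spaces
of `E` at `pr (σ u)` and at `u` are identified definitionally, both being the model space. -/
def projectedDistribution (pr : N → E) (σ : E → N)
    (D : ∀ p : N, Submodule ℝ (TangentSpace 𝓘(ℝ, H) p)) (u : E) :
    Submodule ℝ (TangentSpace 𝓘(ℝ, B) u) :=
  (D (σ u)).map (mfderiv 𝓘(ℝ, H) 𝓘(ℝ, B) pr (σ u)).toLinearMap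

lemma IsIntegralSection.range_mfderiv_comp {ρ : N → M}
    (hψ : IsIntegralSection (m := m) ρ D U ψ)
    (hpr : ContMDiff 𝓘(ℝ, H) 𝓘(ℝ, B) ∞ pr) {x : M} (hx : x ∈ U) :
    (mfderiv 𝓘(ℝ, RSpace m) 𝓘(ℝ, B) (pr ∘ ψ) x).range =
      (D (ψ x)).map (mfderiv 𝓘(ℝ, H) 𝓘(ℝ, B) pr (ψ x)).toLinearMap := by
  rw [mfderiv_comp x (hpr.mdifferentiableAt (by simp)) (hψ.mdifferentiableAt hx),
    ← hψ.tangent x hx]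
  exact LinearMap.range_comp _ _

lemma IsIntegralSection.comp_left (hψ : IsIntegralSection (m := m) (π ∘ pr) D U ψ)
    (hpr : ContMDiff 𝓘(ℝ, H) 𝓘(ℝ, B) ∞ pr) (hσpr : Function.LeftInverse pr σ)
    (hψσ : MapsTo ψ U (range σ)) :
    IsIntegralSection (m := m) π (projectedDistribution (B := B) pr σ D) U (pr ∘ ψ) where
  isOpen := hψ.isOpen
  smooth := hpr.comp_contMDiffOn hψ.smooth
  right_inv := hψ.right_inv
  tangent x hx := by
    obtain ⟨u, hu⟩ := hψσ hx
    have hψx : σ (pr (ψ x)) = ψ x := by rw [← hu, hσpr]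
    rw [hψ.range_mfderiv_comp hpr hx, Function.comp_apply, projectedDistribution]
    rw [hψx]

lemma isFoliated_range (hσpr : Function.LeftInverse pr σ)
    (hint : IsIntegrable (m := m) π (projectedDistribution (B := B) pr σ D))
    (hlifts : ∀ (U : Set M) (γ : M → E),
      IsIntegralSection (m := m) π (projectedDistribution (B := B) pr σ D) U γ →
        IsIntegralSection (m := m) (π ∘ pr) D U (σ ∘ γ)) :
    IsFoliated m (π ∘ pr) D (range σ) := by
  rintro _ ⟨u, rfl⟩
  obtain ⟨U, γ, hU, hγu, hγ⟩ := hint u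
  refine ⟨U, σ ∘ γ, ?_, ?_, hlifts U γ hγ, fun x _ => mem_range_self (γ x)⟩ <;>
    simp only [Function.comp_apply, hσpr u, hU, hγu]

end ProjectedDistributions

section JetProjections

lemma contMDiff_of_fst_chartAt_eq {B W F : Type*} [NormedAddCommGroup B] [NormedSpace ℝ B]
    [NormedAddCommGroup W] [NormedSpace ℝ W] [NormedAddCommGroup F] [NormedSpace ℝ F]
    {E : Type*} [TopologicalSpace E] [ChartedSpace B E]
    {N : Type*} [TopologicalSpace N] [ChartedSpace (W × F) N] [IsManifold 𝓘(ℝ, W × F) ∞ N]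
    {pr : N → E} (h : ∀ q : N, ∃ a : OpenPartialHomeomorph E W, IsSmoothChart B a ∧
      ∀ p ∈ (chartAt (W × F) q).source,
        pr p ∈ a.source ∧ (chartAt (W × F) q p).1 = a (pr p)) :
    ContMDiff 𝓘(ℝ, W × F) 𝓘(ℝ, B) ∞ pr := by
  intro q
  obtain ⟨a, ha, hpr⟩ := h q
  set c := chartAt (W × F) q
  have hfst : ContMDiffOn 𝓘(ℝ, W × F) 𝓘(ℝ, W) ∞ (fun p => (c p).1) c.source :=
    (contDiff_fst.contMDiff (n := ∞)).comp_contMDiffOn contMDiffOn_chart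
  have hmaps : MapsTo (fun p => (c p).1) c.source a.target := fun p hp =>
    mem_of_eq_of_mem (hpr p hp).2 (a.map_source (hpr p hp).1)
  refine ContMDiffOn.contMDiffAt ?_ (c.open_source.mem_nhds (mem_chart_source _ q))
  refine (ha.smooth_symm.comp hfst hmaps).congr fun p hp => ?_
  rw [Function.comp_apply, (hpr p hp).2, a.left_inv (hpr p hp).1]

variable {m n : ℕ}
  {M : Type*} [TopologicalSpace M] [ChartedSpace (RSpace m) M] [IsManifold 𝓘(ℝ, RSpace m) ∞ M]
  {E : Type*} [TopologicalSpace E] [ChartedSpace (RSpace (m + n)) E]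
  [IsManifold 𝓘(ℝ, RSpace (m + n)) ∞ E]
  {π : E → M} [FiberedManifold m n π]

lemma contMDiff_jetProj :
    ContMDiff 𝓘(ℝ, JetModel m n) 𝓘(ℝ, RSpace (m + n)) ∞ (jetProj : Jet m n π → E) :=
  contMDiff_of_fst_chartAt_eq fun j =>
    ⟨(chartNear m n π j.pt).tot, (chartNear m n π j.pt).smooth_tot, fun _ hp => ⟨hp, rfl⟩⟩

lemma contMDiff_dualProj :
    ContMDiff 𝓘(ℝ, DualJetModel m n) 𝓘(ℝ, RSpace (m + n)) ∞ (dualProj : DualJet m n π → E) :=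
  contMDiff_of_fst_chartAt_eq fun q =>
    ⟨(chartNear m n π q.pt).tot, (chartNear m n π q.pt).smooth_tot, fun _ hp => ⟨hp, rfl⟩⟩

lemma isSeparatedMap_jetProj : IsSeparatedMap (jetProj : Jet m n π → E) :=
  isSeparatedMap_of_mem_chartAt_source (H := JetModel m n) fun j j' h =>
    show j'.pt ∈ (chartNear m n π j.pt).tot.source from
      (show j.pt = j'.pt from h) ▸ mem_chartNear j.pt

lemma isSeparatedMap_dualProj : IsSeparatedMap (dualProj : DualJet m n π → E) :=
  isSeparatedMap_of_mem_chartAt_source (H := DualJetModel m n) fun q q' h =>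
    show q'.pt ∈ (chartNear m n π q.pt).tot.source from
      (show q.pt = q'.pt from h) ▸ mem_chartNear q.pt

end JetProjections

section Holonomic

lemma IsLocalSection.range_mfderiv {m n : ℕ}
    {M : Type*} [TopologicalSpace M] [ChartedSpace (RSpace m) M]
    {E : Type*} [TopologicalSpace E] [ChartedSpace (RSpace (m + n)) E]
    {π : E → M} {U : Set M} {φ : M → E}
    (hφ : IsLocalSection (m := m) (H := RSpace (m + n)) π U φ) {x : M} (hx : x ∈ U)
    {A : JetFiber m n π (φ x)} (hA : IsJetAt φ x A) :
    (mfderiv 𝓘(ℝ, RSpace m) 𝓘(ℝ, RSpace (m + n)) φ x).range = A.1.range := by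
  rw [← hA, hφ.mfderiv_comp_eq_id hx]
  rfl

variable {m n : ℕ}
  {M : Type*} [TopologicalSpace M] [ChartedSpace (RSpace m) M] [IsManifold 𝓘(ℝ, RSpace m) ∞ M]
  {E : Type*} [TopologicalSpace E] [ChartedSpace (RSpace (m + n)) E]
  [IsManifold 𝓘(ℝ, RSpace (m + n)) ∞ E]
  {π : E → M} [FiberedManifold m n π]
  {D : ∀ j : Jet m n π, Submodule ℝ (TangentSpace 𝓘(ℝ, JetModel m n) j)}

/-- The integral sections of the distribution `D` on `J¹π` are prolongations of sections of `π`. -/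
def IsHolonomic (D : ∀ j : Jet m n π, Submodule ℝ (TangentSpace 𝓘(ℝ, JetModel m n) j)) : Prop :=
  ∀ (U : Set M) (ψ : M → Jet m n π), IsIntegralSection (m := m) jetBase D U ψ →
    ∃ φ : M → E, IsLocalSection (m := m) (H := RSpace (m + n)) π U φ ∧ IsProlongation U φ ψ

lemma IsHolonomic.map_tangentJetProj (hD : IsHolonomic D)
    (hint : IsIntegrable (m := m) (jetBase : Jet m n π → M) D) (j : Jet m n π) :
    (D j).map (tangentJetProj j).toLinearMap = j.lin.1.range := by
  obtain ⟨U, ψ, hU, hψj, hψ⟩ := hint j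
  obtain ⟨φ, hφ, hpro⟩ := hD U ψ hψ
  obtain ⟨A, hA, hψA⟩ := hpro _ hU
  have heq : jetProj ∘ ψ =ᶠ[𝓝 (jetBase j)] φ := by
    filter_upwards [hψ.isOpen.mem_nhds hU] with y hy
    obtain ⟨_, -, hψy⟩ := hpro y hy
    exact congrArg jetProj hψy
  have hrange : (D (ψ (jetBase j))).map (tangentJetProj (ψ (jetBase j))).toLinearMap =
      (ψ (jetBase j)).lin.1.range := by
    refine (hψ.range_mfderiv_comp contMDiff_jetProj hU).symm.trans
      ((congrArg (fun T : RSpace m →L[ℝ] RSpace (m + n) => T.range) heq.mfderiv_eq).trans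
        ((hφ.range_mfderiv hU hA).trans ?_))
    change (⟨_, A⟩ : Jet m n π).lin.1.range = _
    rw [hψA]
  rwa [hψj] at hrange

lemma IsHolonomic.isIntegrable_jetProjected (hD : IsHolonomic D)
    (hint : IsIntegrable (m := m) (jetBase : Jet m n π → M) D) {Ψ : ∀ u : E, JetFiber m n π u}
    (hΨ : IsIntegrableJetField Ψ) : IsIntegrable (m := m) π (jetProjected D Ψ) := by
  intro u
  obtain ⟨U, γ, hγ, hU, hγu, hjet⟩ := hΨ u
  exact ⟨U, γ, hU, hγu, hγ, fun x hx => (hγ.range_mfderiv hx (hjet x hx)).trans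
    (hD.map_tangentJetProj hint ⟨γ x, Ψ (γ x)⟩).symm⟩

end Holonomic

end FieldTheory
end

theorem mainTheorem9_general {m : ℕ}
    {M : Type*} [TopologicalSpace M] [T2Space M] [ChartedSpace (FieldTheory.RSpace m) M]
    [IsManifold 𝓘(ℝ, FieldTheory.RSpace m) ∞ M]
    {B : Type*} [NormedAddCommGroup B] [NormedSpace ℝ B]
    {E : Type*} [TopologicalSpace E] [ChartedSpace B E]
    {H : Type*} [NormedAddCommGroup H] [NormedSpace ℝ H]
    {N : Type*} [TopologicalSpace N] [ChartedSpace H N] [IsManifold 𝓘(ℝ, H) ∞ N]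
    {π : E → M} (hπ : ContMDiff 𝓘(ℝ, B) 𝓘(ℝ, FieldTheory.RSpace m) ∞ π)
    {pr : N → E} (hpr : ContMDiff 𝓘(ℝ, H) 𝓘(ℝ, B) ∞ pr) (hsep : IsSeparatedMap pr)
    {σ : E → N} (hσ : Continuous σ) (hσpr : Function.LeftInverse pr σ)
    {D : ∀ p : N, Submodule ℝ (TangentSpace 𝓘(ℝ, H) p)}
    (hD : FieldTheory.IsSmoothDistribution m D)
    (hT : FieldTheory.IsTransverse (m := m) (π ∘ pr) D)
    (hint : FieldTheory.IsIntegrable (m := m) π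
      (FieldTheory.projectedDistribution (B := B) pr σ D))
    (hlifts : ∀ (U : Set M) (γ : M → E),
      FieldTheory.IsIntegralSection (m := m) π
        (FieldTheory.projectedDistribution (B := B) pr σ D) U γ →
      FieldTheory.IsIntegralSection (m := m) (π ∘ pr) D U (σ ∘ γ)) :
    (∀ (U : Set M) (ψ : M → N), IsPreconnected U →
      FieldTheory.IsIntegralSection (m := m) (π ∘ pr) D U ψ →
      FieldTheory.HasBoundaryConditionsIn U ψ (range σ) →
      FieldTheory.IsIntegralSection (m := m) π
        (FieldTheory.projectedDistribution (B := B) pr σ D) U (pr ∘ ψ)) ∧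
    (∀ (U : Set M) (γ : M → E),
      FieldTheory.IsIntegralSection (m := m) π
        (FieldTheory.projectedDistribution (B := B) pr σ D) U γ →
      ∃ ψ : M → N, FieldTheory.IsIntegralSection (m := m) (π ∘ pr) D U ψ ∧
        MapsTo ψ U (range σ) ∧ EqOn (pr ∘ ψ) γ U) := by
  have hfoliated := FieldTheory.isFoliated_range hσpr hint hlifts
  have hclosed : IsClosed (range σ) :=
    FieldTheory.isClosed_range_of_leftInverse hsep hpr.continuous hσ hσpr
  refine ⟨fun U ψ hU hψ hbc => ?_, fun U γ hγ => ?_⟩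
  · have hmeets := hfoliated.exists_mem_of_boundaryConditions (hπ.comp hpr) hD hT hψ hbc
    exact hψ.comp_left hpr hσpr
      (hfoliated.mapsTo hclosed (hπ.comp hpr) hD hT hψ hU hmeets)
  · exact ⟨σ ∘ γ, hlifts U γ hγ, fun x _ => mem_range_self (γ x), fun x _ => hσpr (γ x)⟩

theorem mainTheorem9 {m n : ℕ}
    {M : Type*} [TopologicalSpace M] [T2Space M] [SecondCountableTopology M]
    [ChartedSpace (FieldTheory.RSpace m) M]
    [IsManifold 𝓘(ℝ, FieldTheory.RSpace m) ∞ M]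
    {E : Type*} [TopologicalSpace E] [T2Space E] [SecondCountableTopology E]
    [ChartedSpace (FieldTheory.RSpace (m + n)) E]
    [IsManifold 𝓘(ℝ, FieldTheory.RSpace (m + n)) ∞ E]
    (π : E → M) [FieldTheory.FiberedManifold m n π]
    (η : ∀ x : M, TangentSpace 𝓘(ℝ, FieldTheory.RSpace m) x [⋀^Fin m]→L[ℝ] ℝ)
    (hη : FieldTheory.IsVolumeForm η) :
    -- Lagrangian formalism
    (∀ (L : FieldTheory.Jet m n π → ℝ),
      ContMDiff 𝓘(ℝ, FieldTheory.JetModel m n) 𝓘(ℝ, ℝ) ∞ L →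
      ∀ (D_L : ∀ j : FieldTheory.Jet m n π,
          Submodule ℝ (TangentSpace 𝓘(ℝ, FieldTheory.JetModel m n) j)),
      FieldTheory.SolvesLagrangianProblem η L D_L →
      ∀ (Ψ : ∀ u : E, FieldTheory.JetFiber m n π u),
      FieldTheory.SolvesGeneralizedLagrangianHJ D_L Ψ →
      (∀ (U : Set M) (ψ : M → FieldTheory.Jet m n π), IsPreconnected U →
        FieldTheory.IsIntegralSection (m := m) FieldTheory.jetBase D_L U ψ →
        FieldTheory.HasBoundaryConditionsIn U ψ (range (FieldTheory.jetLift Ψ)) →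
        FieldTheory.IsIntegralSection (m := m) π (FieldTheory.jetProjected D_L Ψ) U
          (FieldTheory.jetProj ∘ ψ)) ∧
      (∀ (U : Set M) (γ : M → E),
        FieldTheory.IsIntegralSection (m := m) π (FieldTheory.jetProjected D_L Ψ) U γ →
        ∃ ψ : M → FieldTheory.Jet m n π,
          FieldTheory.IsIntegralSection (m := m) FieldTheory.jetBase D_L U ψ ∧
          MapsTo ψ U (range (FieldTheory.jetLift Ψ)) ∧
          EqOn (FieldTheory.jetProj ∘ ψ) γ U)) ∧
    -- Hamiltonian formalism
    (∀ (h : FieldTheory.HamiltonianSection m n π)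
      (D_h : ∀ q : FieldTheory.DualJet m n π,
          Submodule ℝ (TangentSpace 𝓘(ℝ, FieldTheory.DualJetModel m n) q)),
      FieldTheory.SolvesHamiltonianProblem h D_h →
      ∀ (s : ∀ u : E, FieldTheory.ReducedForms
          (mfderiv 𝓘(ℝ, FieldTheory.RSpace (m + n)) 𝓘(ℝ, FieldTheory.RSpace m) π u) m),
      FieldTheory.SolvesGeneralizedHamiltonianHJ D_h s →
      (∀ (U : Set M) (ψ : M → FieldTheory.DualJet m n π), IsPreconnected U →
        FieldTheory.IsIntegralSection (m := m) FieldTheory.dualBase D_h U ψ →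
        FieldTheory.HasBoundaryConditionsIn U ψ (range (FieldTheory.dualLift s)) →
        FieldTheory.IsIntegralSection (m := m) π (FieldTheory.dualProjected D_h s) U
          (FieldTheory.dualProj ∘ ψ)) ∧
      (∀ (U : Set M) (γ : M → E),
        FieldTheory.IsIntegralSection (m := m) π (FieldTheory.dualProjected D_h s) U γ →
        ∃ ψ : M → FieldTheory.DualJet m n π,
          FieldTheory.IsIntegralSection (m := m) FieldTheory.dualBase D_h U ψ ∧
          MapsTo ψ U (range (FieldTheory.dualLift s)) ∧
          EqOn (FieldTheory.dualProj ∘ ψ) γ U)) := by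
  exact ⟨
    fun _ _ _ hD _ hΨ => mainTheorem9_general FieldTheory.FiberedManifold.contMDiff
      FieldTheory.contMDiff_jetProj FieldTheory.isSeparatedMap_jetProj hΨ.isSmooth.continuous
      (fun _ => rfl) hD.isSmooth hD.isTransverse
      (FieldTheory.IsHolonomic.isIntegrable_jetProjected hD.holonomic hD.isIntegrable
        hΨ.isIntegrable) hΨ.lifts,
    fun _ _ hD _ hs => mainTheorem9_general FieldTheory.FiberedManifold.contMDiff
      FieldTheory.contMDiff_dualProj FieldTheory.isSeparatedMap_dualProj hs.isSmooth.continuous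
      (fun _ => rfl) hD.isSmooth hD.isTransverse hs.isIntegrable hs.lifts⟩
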